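/- Let $d\ge 2$ and let $\mathbb{T}^d=\mathbb{R}^d/2\pi\mathbb{Z}^d$, with canonical projection $\mathfrak{p}:\mathbb{R}^d\to\mathbb{T}^d$. Let $K\subset\mathbb{R}^d$ be either a single point, or a nonempty compact convex set whose boundary $\partial K$ is a smooth hypersurface all of whose principal curvatures (with respect to the outward normal, with the sign for which spheres have positive curvature) are positive; for $d\geq 3$ the curvature condition says that all sectional curvatures of $\partial K$ are positive. For $t>0$ let $K_t=K+tB_d$, where $B_d$ is the closed Euclidean unit ball, let $\Sigma_t=\mathfrak{p}(\partial K_t)$, and let $\mathrm{Vol}_{\Sigma_t}$ be the volume measure induced on the immersed hypersurface $\Sigma_t$ by the Euclidean structure, that is, the image under $\mathfrak{p}$ of the $(d-1)$-dimensional Euclidean volume measure on $\partial K_t$. For $f\in C^\infty(\mathbb{T}^d)$ (complex-valued) put $$\|f\|_{H^{s}(\mathbb{T}^d)}^2=\sum_{\xi\in\mathbb{Z}^d}(1+|\xi|^2)^{s}\,|\widehat f_\xi|^2,\qquad \widehat f_\xi=\int_{\mathbb{T}^d}f(x)\,\frac{e^{-i\xi\cdot x}}{(2\pi)^{d/2}}\,dx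 .$$ Then there are constants $C>0$ and $t_0>0$, depending only on $d$ and $K$, such that for every $t\ge t_0$ the total volume $\mathrm{Vol}(\Sigma_t)$ is positive and finite, and every $f\in C^\infty(\mathbb{T}^d)$ is integrable for $\mathrm{Vol}_{\Sigma_t}$ and satisfies $$\left|\frac{1}{\mathrm{Vol}(\Sigma_t)}\int_{\Sigma_t}f\,d\mathrm{Vol}_{\Sigma_t}-\frac{1}{(2\pi)^d}\int_{\mathbb{T}^d}f(x)\,dx\right|\le C\,\|f\|_{H^{2d+1}(\mathbb{T}^d)}\,t^{-\frac{d-1}{2}} .$$ -/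

import Mathlib

open MeasureTheory Set
open scoped ContDiff Pointwise ComplexConjugate

noncomputable section

namespace ConvexEquidistribution

instance factTwoPiPos : Fact (0 < 2 * Real.pi) := ⟨Real.two_pi_pos⟩

/-- Euclidean space `ℝ^d`. -/
abbrev E (d : ℕ) : Type := EuclideanSpace ℝ (Fin d)

/-- The flat torus `𝕋^d = ℝ^d / 2πℤ^d`, as the product of `d` circles `ℝ / 2πℤ`.  Its canonical
measure `volume` is the Lebesgue measure, of total mass `(2π)^d`. -/
abbrev Torus (d : ℕ) : Type := Fin d → AddCircle (2 * Real.pi)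

/-- The canonical projection `𝔭 : ℝ^d → 𝕋^d`. -/
def proj (d : ℕ) (x : E d) : Torus d := fun i => (x i : AddCircle (2 * Real.pi))

/-- `f ∈ C^∞(𝕋^d)`: the `2πℤ^d`-periodic lift of `f` to `ℝ^d` is smooth (the projection is a local
diffeomorphism for the quotient smooth structure). -/
def IsSmooth {d : ℕ} (f : Torus d → ℂ) : Prop :=
  ContDiff ℝ ∞ (fun x : E d => f (proj d x))

/-- The orthonormal Fourier basis `e_ξ(x) = e^{i ξ·x} / (2π)^{d/2}` of `L²(𝕋^d)`. -/
def fourierMode {d : ℕ} (ξ : Fin d → ℤ) (x : Torus d) : ℂ :=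
  (((2 * Real.pi) ^ (-(d : ℝ) / 2) : ℝ) : ℂ) * ∏ i, fourier (ξ i) (x i)

/-- The Fourier coefficient `⟨f, e_ξ⟩ = ∫_{𝕋^d} f(x) conj(e_ξ(x)) dx`. -/
def fourierCoeffTorus {d : ℕ} (f : Torus d → ℂ) (ξ : Fin d → ℤ) : ℂ :=
  ∫ x, f x * conj (fourierMode ξ x)

/-- The Sobolev norm `‖f‖_{H^s(𝕋^d)} = (∑_{ξ ∈ ℤ^d} (1 + |ξ|²)^s |⟨f, e_ξ⟩|²)^{1/2}`
(only used for smooth `f`, for which the sum is finite). -/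
def sobolevNorm {d : ℕ} (s : ℝ) (f : Torus d → ℂ) : ℝ :=
  Real.sqrt (∑' ξ : Fin d → ℤ,
    (1 + ∑ i, (ξ i : ℝ) ^ 2) ^ s * ‖fourierCoeffTorus f ξ‖ ^ 2)

/-- `ρ` is a smooth local defining function of `K` at `x`: near `x` the set `K` is the sublevel set
`{ρ ≤ 0}`, and `dρ(x) ≠ 0`.  (A function that is only defined near `x` can be cut off,
so nothing is lost by taking `ρ` smooth on all of `ℝ^d`.) -/
structure IsLocalDefiningFunction {d : ℕ} (K : Set (E d)) (x : E d) (ρ : E d → ℝ) : Prop where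
  smooth : ContDiff ℝ ∞ ρ
  fderiv_ne_zero : fderiv ℝ ρ x ≠ 0
  mem_iff : ∀ᶠ y in nhds x, y ∈ K ↔ ρ y ≤ 0

/-- The compact convex sets `K ⊆ ℝ^d` that are strictly convex with smooth boundary:
either `K` is a point, or `K` is a compact convex set whose boundary is a smooth hypersurface all
of whose principal curvatures are positive.
If `ρ` is a local defining function at the boundary point `x`, then
`T_x ∂K = ker dρ(x)`, and the second fundamental form of `∂K` at `x` (with the sign for which
spheres are positive) is the restriction of `D²ρ(x) / |∇ρ(x)|` to `T_x ∂K`; the principal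
curvatures are its eigenvalues.
For `d ≥ 3` their positivity is the positivity of all sectional curvatures of `∂K`. -/
def IsStrictlyConvexSmooth {d : ℕ} (K : Set (E d)) : Prop :=
  (∃ x₀, K = {x₀}) ∨
    (K.Nonempty ∧ IsCompact K ∧ Convex ℝ K ∧
      ∀ x ∈ frontier K, ∃ ρ : E d → ℝ, IsLocalDefiningFunction K x ρ ∧
        ∀ v : E d, v ≠ 0 → fderiv ℝ ρ x v = 0 → 0 < fderiv ℝ (fderiv ℝ ρ) x v v)

/-- The parallel body `K_t = K + t B_d`, where `B_d` is the closed Euclidean unit ball. -/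
def parallelBody {d : ℕ} (K : Set (E d)) (t : ℝ) : Set (E d) :=
  K + t • Metric.closedBall (0 : E d) 1

/-- The volume measure on `Σ_t = 𝔭(∂K_t)`, viewed as a measure on `𝕋^d`.  Since `𝔭` is a local
isometry, it immerses the hypersurface `∂K_t` isometrically, and the volume measure of the immersed
hypersurface is the image under `𝔭` of the Euclidean `(d-1)`-dimensional volume measure on `∂K_t`
(the `(d-1)`-dimensional Hausdorff measure, normalized so as to agree with Lebesgue measure on
hyperplanes). -/
def surfaceMeasure {d : ℕ} (K : Set (E d)) (t : ℝ) : Measure (Torus d) :=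
  ((μHE[d - 1] : Measure (E d)).restrict (frontier (parallelBody K t))).map (proj d)

end ConvexEquidistribution

end

/-! Write n = d − 1 and let y(θ) be the point of K with outer normal θ. The boundary of K_t is the
image of the unit sphere under θ ↦ y(θ) + tθ. When K has a boundary, its positive curvature makes y
single-valued (no segments in the boundary) and smooth (implicit function theorem for the Lagrange
multiplier equations). When K is a point, y is constant. From
`IsStrictlyConvexSmooth.exists_isSmoothSupportMap` on, the two cases are treated together.

The Jacobian of the parametrization is t^n det(1 + t⁻¹ Dy(θ)). The determinant tends to 1 uniformly
on the sphere, so the volume is at least c t^n for large t. The Fourier integral of the surface at a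
frequency ξ ≠ 0 is t^n ∫ e^{i t⟨ξ,θ⟩} e^{i⟨ξ,y(θ)⟩} det(1 + t⁻¹ Dy(θ)) dθ. With e = ξ/|ξ|, the large
phase is t|ξ| times the height ⟨θ,e⟩, whose only critical points are ±e. On every meridian from −e
to e it equals −t|ξ| cos φ, and the area element carries sin^{n−1} φ dφ. Stationary phase on the
sphere thus becomes a one-dimensional estimate with an explicit phase,
`exists_norm_integral_cosWave_sin_pow_le`, giving decay (t|ξ|)^{−n/2} uniformly over meridians. The
amplitude contains ξ but no growing power of t; its n derivatives cost (1 + |ξ|)^n.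

No measure on the n-sphere of normals has to be built: stereographic coordinates with pole e
parametrize all but one point of the boundary by a vector space, where the area formula for
injective immersions applies (`IsSmoothSupportMap.restrict_frontier_eq_map`). Polar coordinates in
that vector space produce the meridians (`norm_integral_stereo_le`). The outcome is
`IsStrictlyConvexSmooth.exists_surface_bounds`.

Finally f is expanded in its Fourier series. The zero mode reproduces the mean exactly, and every
other mode has average O((1 + |ξ|)^n t^{−n/2}). Cauchy–Schwarz against the Sobolev weight sums the
errors, since n + d ≤ 2d + 1 (`exists_norm_average_sub_le`). -/

noncomputable section

namespace ConvexEquidistribution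

section OscillatoryIntegrals

/-! ### Oscillatory integrals with phase `cos` on `[0, π]` -/

/-- The oscillating factor `e^{-i l cos φ}`. -/
def cosWave (l φ : ℝ) : ℂ := Complex.exp (((-(l * Real.cos φ) : ℝ) : ℂ) * Complex.I)

lemma norm_cosWave (l φ : ℝ) : ‖cosWave l φ‖ = 1 := Complex.norm_exp_ofReal_mul_I _

lemma continuous_cosWave (l : ℝ) : Continuous (cosWave l) := by
  unfold cosWave; fun_prop

lemma hasDerivAt_cosWave (l φ : ℝ) :
    HasDerivAt (cosWave l) (cosWave l φ * (((l * Real.sin φ : ℝ) : ℂ) * Complex.I)) φ := by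
  have h : HasDerivAt (fun φ : ℝ => -(l * Real.cos φ)) (l * Real.sin φ) φ := by
    convert! ((Real.hasDerivAt_cos φ).const_mul l).neg using 1
    ring
  exact (h.ofReal_comp.mul_const Complex.I).cexp

/-- One integration by parts against `e^{-i l cos φ} sin φ`. -/
lemma integral_cosWave_mul_sin {l a b : ℝ} (hl : l ≠ 0) {H H' : ℝ → ℂ}
    (hH : ∀ x ∈ uIcc a b, HasDerivAt H (H' x) x) (hH' : IntervalIntegrable H' volume a b) :
    ∫ φ in a..b, cosWave l φ * (Real.sin φ : ℂ) * H φ =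
      ((l : ℂ) * Complex.I)⁻¹ * (cosWave l b * H b - cosWave l a * H a
        - ∫ φ in a..b, cosWave l φ * H' φ) := by
  have key := intervalIntegral.integral_deriv_mul_eq_sub
    (u := cosWave l) (v := H)
    (u' := fun φ => cosWave l φ * (((l * Real.sin φ : ℝ) : ℂ) * Complex.I))
    (v' := H') (a := a) (b := b) (fun x _ => hasDerivAt_cosWave l x) hH
    (by apply Continuous.intervalIntegrable; have := continuous_cosWave l; fun_prop) hH'
  have hcH : ContinuousOn H (uIcc a b) := fun x hx => (hH x hx).continuousAt.continuousWithinAt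
  have hc := continuous_cosWave l
  rw [intervalIntegral.integral_add] at key
  · rw [← key]
    have hli : (l : ℂ) ≠ 0 := by simp [hl]
    rw [add_sub_cancel_right, ← intervalIntegral.integral_const_mul]
    congr 1; ext φ
    push_cast
    field_simp
  · exact (ContinuousOn.mul (by fun_prop) hcH).intervalIntegrable
  · exact hH'.continuousOn_mul hc.continuousOn

lemma norm_integral_cosWave_mul_sin_le {l a b : ℝ} (hl : 0 < l) {H H' : ℝ → ℂ}
    (hH : ∀ x ∈ uIcc a b, HasDerivAt H (H' x) x) (hH' : IntervalIntegrable H' volume a b) :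
    ‖∫ φ in a..b, cosWave l φ * (Real.sin φ : ℂ) * H φ‖ ≤
      l⁻¹ * (‖H b‖ + ‖H a‖ + ‖∫ φ in a..b, cosWave l φ * H' φ‖) := by
  rw [integral_cosWave_mul_sin hl.ne' hH hH', norm_mul]
  have : ‖((l : ℂ) * Complex.I)⁻¹‖ = l⁻¹ := by simp [abs_of_pos hl]
  rw [this]
  gcongr
  refine (norm_sub_le _ _).trans ?_
  gcongr
  refine (norm_sub_le _ _).trans ?_
  simp [norm_cosWave]

lemma norm_integral_cosWave_mul_le {l a b M : ℝ} (hab : a ≤ b) {G : ℝ → ℂ}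
    (hG : ∀ φ, ‖G φ‖ ≤ M) : ‖∫ φ in a..b, cosWave l φ * G φ‖ ≤ M * (b - a) := by
  have := intervalIntegral.norm_integral_le_of_norm_le_const (a := a) (b := b) (C := M)
    (f := fun φ => cosWave l φ * G φ) (fun x _ => by simpa [norm_cosWave] using hG x)
  rwa [abs_of_nonneg (sub_nonneg.2 hab)] at this

lemma sin_ge_of_mem {δ φ : ℝ} (hδ : 0 < δ)
    (hφ : φ ∈ Icc δ (Real.pi - δ)) : 2 / Real.pi * δ ≤ Real.sin φ := by
  rcases le_total φ (Real.pi / 2) with h | h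
  · exact (mul_le_mul_of_nonneg_left hφ.1 (by positivity)).trans
      (Real.mul_le_sin (hδ.le.trans hφ.1) h)
  · rw [← Real.sin_pi_sub]
    exact (mul_le_mul_of_nonneg_left (by linarith [hφ.2]) (by positivity)).trans
      (Real.mul_le_sin (by linarith [hφ.2]) (by linarith))

/-- The primitive is −cot, and Jordan's inequality bounds cot δ by π/(2δ). -/
lemma integral_inv_sin_sq_le {δ : ℝ} (hδ : 0 < δ) (hδ' : δ ≤ Real.pi / 2) :
    ∫ φ in δ..(Real.pi - δ), (Real.sin φ ^ 2)⁻¹ ≤ Real.pi / δ := by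
  have hpi := Real.pi_pos
  have hu : uIcc δ (Real.pi - δ) = Icc δ (Real.pi - δ) := uIcc_of_le (by linarith)
  have hpos : ∀ φ ∈ Icc δ (Real.pi - δ), 0 < Real.sin φ := fun φ h =>
    lt_of_lt_of_le (by positivity) (sin_ge_of_mem hδ h)
  have hs := hpos δ ⟨le_rfl, by linarith⟩
  rw [intervalIntegral.integral_eq_sub_of_hasDerivAt
    (f := fun φ => -(Real.cos φ / Real.sin φ)) (f' := fun φ => (Real.sin φ ^ 2)⁻¹)]
  · rw [Real.cos_pi_sub, Real.sin_pi_sub]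
    have h1 : 2 / Real.pi * δ ≤ Real.sin δ := sin_ge_of_mem hδ ⟨le_rfl, by linarith⟩
    have h2 : Real.cos δ / Real.sin δ ≤ 1 / (2 / Real.pi * δ) := by
      gcongr
      exact Real.cos_le_one δ
    have h3 : 1 / (2 / Real.pi * δ) = Real.pi / δ / 2 := by field_simp
    have h4 : -(-Real.cos δ / Real.sin δ) - -(Real.cos δ / Real.sin δ)
      = 2 * (Real.cos δ / Real.sin δ) := by ring
    rw [h4]; linarith
  · intro φ hφ
    rw [hu] at hφ
    have := (hpos φ hφ).ne'
    convert! ((Real.hasDerivAt_cos φ).div (Real.hasDerivAt_sin φ) this).neg using 1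
    field_simp
    nlinarith [Real.sin_sq_add_cos_sq φ]
  · apply ContinuousOn.intervalIntegrable
    rw [hu]
    exact ContinuousOn.inv₀ (by fun_prop) fun φ h => ne_of_gt (pow_pos (hpos φ h) 2)

/-- Van der Corput bound for the phase `cos` with its two nondegenerate critical points. -/
lemma norm_integral_cosWave_le {l M : ℝ} (hl : 1 ≤ l) {G G' : ℝ → ℂ}
    (hG : ∀ φ, HasDerivAt G (G' φ) φ) (hc : Continuous G')
    (hM : ∀ φ, ‖G φ‖ ≤ M) (hM' : ∀ φ, ‖G' φ‖ ≤ M) :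
    ‖∫ φ in (0 : ℝ)..Real.pi, cosWave l φ * G φ‖ ≤ (3 * Real.pi + 2) * M * l ^ (-(1 / 2) : ℝ) := by
  have hpi := Real.pi_pos
  have hpi3 := Real.pi_gt_three
  have hl0 : 0 < l := by linarith
  have hM0 : 0 ≤ M := (norm_nonneg _).trans (hM 0)
  -- Intervals of length δ at the two critical points are estimated trivially, by 2Mδ in total.
  -- Integrating by parts in the middle costs l⁻¹ · 3πM/δ. The choice l⁻¹ = δ² balances the two.
  set δ : ℝ := l ^ (-(1 / 2) : ℝ) with hδdef
  have hδ : 0 < δ := Real.rpow_pos_of_pos hl0 _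
  have hδ1 : δ ≤ 1 := Real.rpow_le_one_of_one_le_of_nonpos hl (by norm_num)
  have hδ' : δ ≤ Real.pi / 2 := by linarith
  have hld : l⁻¹ = δ * δ := by
    rw [hδdef, ← Real.rpow_add hl0]; norm_num [Real.rpow_neg_one]
  have hcG : Continuous G := continuous_iff_continuousAt.2 fun x => (hG x).continuousAt
  have hcw := continuous_cosWave l
  have hint : ∀ a b : ℝ, IntervalIntegrable (fun φ => cosWave l φ * G φ) volume a b := fun a b =>
    (hcw.mul hcG).intervalIntegrable a b
  have hsplit : ∫ φ in (0 : ℝ)..Real.pi, cosWave l φ * G φ =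
      (∫ φ in (0 : ℝ)..δ, cosWave l φ * G φ) + (∫ φ in δ..(Real.pi - δ), cosWave l φ * G φ)
        + ∫ φ in (Real.pi - δ)..Real.pi, cosWave l φ * G φ := by
    rw [intervalIntegral.integral_add_adjacent_intervals (hint _ _) (hint _ _),
      intervalIntegral.integral_add_adjacent_intervals (hint _ _) (hint _ _)]
  have h1 : ‖∫ φ in (0 : ℝ)..δ, cosWave l φ * G φ‖ ≤ M * (δ - 0) :=
    norm_integral_cosWave_mul_le hδ.le hM
  have h3 : ‖∫ φ in (Real.pi - δ)..Real.pi, cosWave l φ * G φ‖ ≤ M * (Real.pi - (Real.pi - δ)) :=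
    norm_integral_cosWave_mul_le (by linarith) hM
  have hle : δ ≤ Real.pi - δ := by linarith
  have hu : uIcc δ (Real.pi - δ) = Icc δ (Real.pi - δ) := uIcc_of_le hle
  have hlow := fun φ (h : φ ∈ Icc δ (Real.pi - δ)) => sin_ge_of_mem hδ h
  have hpos : ∀ φ ∈ Icc δ (Real.pi - δ), 0 < Real.sin φ := fun φ h =>
    lt_of_lt_of_le (by positivity) (hlow φ h)
  have hne : ∀ φ ∈ Icc δ (Real.pi - δ), (Real.sin φ : ℂ) ≠ 0 := fun φ h =>
    Complex.ofReal_ne_zero.2 (hpos φ h).ne'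
  set H : ℝ → ℂ := fun φ => G φ / (Real.sin φ : ℂ) with hHdef
  set H' : ℝ → ℂ := fun φ =>
    (G' φ * (Real.sin φ : ℂ) - G φ * (Real.cos φ : ℂ)) / (Real.sin φ : ℂ) ^ 2 with hH'def
  have hH : ∀ x ∈ uIcc δ (Real.pi - δ), HasDerivAt H (H' x) x := fun x hx =>
    (hG x).div (Real.hasDerivAt_sin x).ofReal_comp (hne x (hu ▸ hx))
  have hH'i : IntervalIntegrable H' volume δ (Real.pi - δ) := by
    apply ContinuousOn.intervalIntegrable
    rw [hu]
    refine ContinuousOn.div (by fun_prop) (by fun_prop) fun φ h => pow_ne_zero 2 (hne φ h)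
  have h2 : ‖∫ φ in δ..(Real.pi - δ), cosWave l φ * G φ‖ ≤ 3 * Real.pi * M * δ := by
    have heq : ∫ φ in δ..(Real.pi - δ), cosWave l φ * G φ =
        ∫ φ in δ..(Real.pi - δ), cosWave l φ * (Real.sin φ : ℂ) * H φ := by
      apply intervalIntegral.integral_congr
      intro φ hφ
      have := hne φ (hu ▸ hφ)
      simp only [hHdef]
      field_simp
    rw [heq]
    refine (norm_integral_cosWave_mul_sin_le hl0 hH hH'i).trans ?_
    have hHb : ∀ φ ∈ Icc δ (Real.pi - δ), ‖H φ‖ ≤ M * Real.pi / (2 * δ) := by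
      intro φ hφ
      simp only [hHdef, norm_div, Complex.norm_real, Real.norm_eq_abs, abs_of_pos (hpos φ hφ)]
      calc ‖G φ‖ / Real.sin φ ≤ M / (2 / Real.pi * δ) := by
            gcongr
            · exact hM φ
            · exact hlow φ hφ
        _ = _ := by field_simp
    have hHI : ‖∫ φ in δ..(Real.pi - δ), cosWave l φ * H' φ‖ ≤ 2 * M * (Real.pi / δ) := by
      calc ‖∫ φ in δ..(Real.pi - δ), cosWave l φ * H' φ‖
          ≤ ∫ φ in δ..(Real.pi - δ), 2 * M * (Real.sin φ ^ 2)⁻¹ := by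
            apply intervalIntegral.norm_integral_le_of_norm_le hle
            · refine Filter.Eventually.of_forall fun φ hφ => ?_
              have hp := hpos φ ⟨hφ.1.le, hφ.2⟩
              simp only [norm_mul, norm_cosWave, one_mul, hH'def, norm_div, norm_pow,
                Complex.norm_real, Real.norm_eq_abs, sq_abs]
              rw [div_eq_mul_inv]
              gcongr
              refine (norm_sub_le _ _).trans ?_
              simp only [norm_mul, Complex.norm_real, Real.norm_eq_abs]
              have a1 := mul_le_mul (hM' φ) (Real.abs_sin_le_one φ) (abs_nonneg _) hM0
              have a2 := mul_le_mul (hM φ) (Real.abs_cos_le_one φ) (abs_nonneg _) hM0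
              linarith
            · apply ContinuousOn.intervalIntegrable
              rw [hu]
              exact ContinuousOn.mul (by fun_prop) <|
                ContinuousOn.inv₀ (by fun_prop) fun φ h => ne_of_gt (pow_pos (hpos φ h) 2)
        _ ≤ _ := by
            rw [intervalIntegral.integral_const_mul]
            gcongr
            exact integral_inv_sin_sq_le hδ hδ'
    have hb1 := hHb δ ⟨le_rfl, hle⟩
    have hb2 := hHb (Real.pi - δ) ⟨hle, le_rfl⟩
    calc l⁻¹ * (‖H (Real.pi - δ)‖ + ‖H δ‖ + ‖∫ φ in δ..(Real.pi - δ), cosWave l φ * H' φ‖)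
        ≤ δ * δ * (M * Real.pi / (2 * δ) + M * Real.pi / (2 * δ) + 2 * M * (Real.pi / δ)) := by
          rw [hld]; gcongr
      _ = 3 * Real.pi * M * δ := by field_simp; ring
  rw [hsplit]
  refine (norm_add_le _ _).trans ((add_le_add_left (norm_add_le _ _) _).trans ?_)
  nlinarith

/-- Leibniz' rule; the binomial coefficients sum to 2^j ≤ 2^k. -/
lemma norm_iteratedDeriv_mul_le {f g : ℝ → ℂ} (hf : ContDiff ℝ ∞ f) (hg : ContDiff ℝ ∞ g)
    {k j : ℕ} (hj : j ≤ k) {A B : ℝ} (hA : ∀ i ≤ k, ∀ x, ‖iteratedDeriv i f x‖ ≤ A)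
    (hB : ∀ i ≤ k, ∀ x, ‖iteratedDeriv i g x‖ ≤ B) (x : ℝ) :
    ‖iteratedDeriv j (fun x => f x * g x) x‖ ≤ 2 ^ k * A * B := by
  have hA0 : 0 ≤ A := (norm_nonneg _).trans (hA 0 (Nat.zero_le _) x)
  have hB0 : 0 ≤ B := (norm_nonneg _).trans (hB 0 (Nat.zero_le _) x)
  rw [← norm_iteratedFDeriv_eq_norm_iteratedDeriv]
  refine (norm_iteratedFDeriv_mul_le hf hg x (n := j) (by exact_mod_cast le_top)).trans ?_
  calc _ ≤ ∑ i ∈ Finset.range (j + 1), (j.choose i : ℝ) * A * B := by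
        refine Finset.sum_le_sum fun i hi => ?_
        rw [norm_iteratedFDeriv_eq_norm_iteratedDeriv, norm_iteratedFDeriv_eq_norm_iteratedDeriv]
        have := Finset.mem_range.1 hi
        gcongr
        · exact hA i (by omega) x
        · exact hB _ (by omega) x
    _ = 2 ^ j * A * B := by
        rw [← Finset.sum_mul, ← Finset.sum_mul]
        congr 2
        exact_mod_cast Nat.sum_range_choose j
    _ ≤ _ := by
        gcongr
        norm_num

lemma norm_iteratedDeriv_ofReal_sin_le (i : ℕ) (x : ℝ) :
    ‖iteratedDeriv i (fun x : ℝ => (Real.sin x : ℂ)) x‖ ≤ 1 := by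
  rw [← norm_iteratedFDeriv_eq_norm_iteratedDeriv]
  have := Complex.ofRealLI.norm_iteratedFDeriv_comp_left (f := Real.sin) (x := x) (i := i)
    (n := ∞) Real.contDiff_sin.contDiffAt (by exact_mod_cast le_top)
  rw [show (fun x : ℝ => (Real.sin x : ℂ)) = Complex.ofRealLI ∘ Real.sin from rfl, this,
    norm_iteratedFDeriv_eq_norm_iteratedDeriv]
  exact Real.abs_iteratedDeriv_sin_le_one i x

lemma norm_iteratedDeriv_ofReal_cos_le (i : ℕ) (x : ℝ) :
    ‖iteratedDeriv i (fun x : ℝ => (Real.cos x : ℂ)) x‖ ≤ 1 := by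
  rw [← norm_iteratedFDeriv_eq_norm_iteratedDeriv]
  have := Complex.ofRealLI.norm_iteratedFDeriv_comp_left (f := Real.cos) (x := x) (i := i)
    (n := ∞) Real.contDiff_cos.contDiffAt (by exact_mod_cast le_top)
  rw [show (fun x : ℝ => (Real.cos x : ℂ)) = Complex.ofRealLI ∘ Real.cos from rfl, this,
    norm_iteratedFDeriv_eq_norm_iteratedDeriv]
  exact Real.abs_iteratedDeriv_cos_le_one i x

lemma contDiff_ofReal_sin : ContDiff ℝ ∞ (fun x : ℝ => (Real.sin x : ℂ)) :=
  Complex.ofRealCLM.contDiff.comp Real.contDiff_sin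

lemma contDiff_ofReal_cos : ContDiff ℝ ∞ (fun x : ℝ => (Real.cos x : ℂ)) :=
  Complex.ofRealCLM.contDiff.comp Real.contDiff_cos

/-- Stationary phase for `∫_0^π e^{-i l cos φ} sin^m φ G(φ) dφ`. -/
theorem exists_norm_integral_cosWave_sin_pow_le (m : ℕ) :
    ∃ C : ℝ, 0 ≤ C ∧ ∀ (G : ℝ → ℂ) (M l : ℝ), ContDiff ℝ ∞ G →
      (∀ j ≤ m + 1, ∀ φ, ‖iteratedDeriv j G φ‖ ≤ M) → 1 ≤ l →
      ‖∫ φ in (0 : ℝ)..Real.pi, cosWave l φ * (Real.sin φ : ℂ) ^ m * G φ‖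
        ≤ C * M * l ^ (-((m : ℝ) + 1) / 2) := by
  have hder : ∀ {G : ℝ → ℂ}, ContDiff ℝ ∞ G → ∀ φ, HasDerivAt G (deriv G φ) φ := fun hG φ =>
    (hG.differentiable (by simp) φ).hasDerivAt
  have hcder : ∀ {G : ℝ → ℂ}, ContDiff ℝ ∞ G → ContDiff ℝ ∞ (deriv G) := fun hG =>
    (contDiff_infty_iff_deriv.1 hG).2
  induction m using Nat.twoStepInduction with
  | zero =>
    refine ⟨3 * Real.pi + 2, by positivity, fun G M l hG hM hl => ?_⟩
    have := norm_integral_cosWave_le hl (hder hG) (hcder hG).continuous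
      (fun φ => by simpa using hM 0 (by simp) φ) (fun φ => by simpa using hM 1 (by simp) φ)
    have e : -(((0 : ℕ) : ℝ) + 1) / 2 = -(1 / 2) := by norm_num
    rw [e]
    simpa using this
  | one =>
    refine ⟨2 + Real.pi, by positivity, fun G M l hG hM hl => ?_⟩
    have hl0 : 0 < l := by linarith
    have h := norm_integral_cosWave_mul_sin_le (a := 0) (b := Real.pi) hl0
      (fun x _ => hder hG x) ((hcder hG).continuous.intervalIntegrable _ _)
    have h0 : ∀ φ, ‖G φ‖ ≤ M := fun φ => by simpa using hM 0 (by simp) φ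
    have h1 := norm_integral_cosWave_mul_le (l := l) Real.pi_pos.le
      (fun φ => by simpa using hM 1 (by simp) φ : ∀ φ, ‖deriv G φ‖ ≤ M)
    simp only [pow_one]
    refine h.trans ?_
    have : l ^ (-((1 : ℕ) + 1 : ℝ) / 2) = l⁻¹ := by norm_num [Real.rpow_neg_one]
    rw [this, mul_comm]
    gcongr
    linarith [h0 0, h0 Real.pi]
  | more m ih _ =>
    obtain ⟨C, hC, ih⟩ := ih
    refine ⟨C * (2 ^ (m + 1) * (m + 1) + 2 ^ (m + 1)), by positivity, fun G M l hG hM hl => ?_⟩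
    have hl0 : 0 < l := by linarith
    have hM0 : 0 ≤ M := (norm_nonneg _).trans (hM 0 (Nat.zero_le _) 0)
    -- One factor sin is spent on integrating by parts. The boundary terms vanish because sin^(m+1)
    -- does at 0 and π, and the derivative of sin^(m+1) · G is sin^m · G₁. So two powers of sin gain
    -- l⁻¹, and G₁ involves one more derivative of G. The constant below is the sum of the Leibniz
    -- bounds for the two terms of G₁.
    set G₁ : ℝ → ℂ := fun φ => ((m : ℂ) + 1) * ((Real.cos φ : ℂ) * G φ)
      + (Real.sin φ : ℂ) * deriv G φ with hG₁
    have hcG : ContDiff ℝ ∞ G₁ :=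
      (contDiff_const.mul (contDiff_ofReal_cos.mul hG)).add (contDiff_ofReal_sin.mul (hcder hG))
    have hH : ∀ x ∈ uIcc 0 Real.pi, HasDerivAt (fun φ => (Real.sin φ : ℂ) ^ (m + 1) * G φ)
        ((Real.sin x : ℂ) ^ m * G₁ x) x := by
      intro x _
      convert! (((Real.hasDerivAt_sin x).ofReal_comp).pow (m + 1)).mul (hder hG x) using 1
      simp only [hG₁, Nat.add_sub_cancel, Pi.pow_apply]
      push_cast
      ring
    have h := norm_integral_cosWave_mul_sin_le (a := 0) (b := Real.pi) hl0 hH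
      (by apply Continuous.intervalIntegrable; have := hcG.continuous; fun_prop)
    have hb := ih G₁ ((2 ^ (m + 1) * (m + 1) + 2 ^ (m + 1)) * M) l hcG ?_ hl
    · calc _ = ‖∫ φ in (0 : ℝ)..Real.pi, cosWave l φ * (Real.sin φ : ℂ)
              * ((Real.sin φ : ℂ) ^ (m + 1) * G φ)‖ := by
            congr 2; ext φ; ring
        _ ≤ _ := h
        _ = l⁻¹ * ‖∫ φ in (0 : ℝ)..Real.pi, cosWave l φ * (Real.sin φ : ℂ) ^ m * G₁ φ‖ := by
            simp [mul_assoc]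
        _ ≤ l⁻¹ * _ := mul_le_mul_of_nonneg_left hb (by positivity)
        _ = _ := by
            have : l ^ (-(((m + 2 : ℕ) : ℝ) + 1) / 2) = l⁻¹ * l ^ (-((m : ℝ) + 1) / 2) := by
              rw [← Real.rpow_neg_one l, ← Real.rpow_add hl0]
              congr 1; push_cast; ring
            rw [this]; ring
    · intro j hj φ
      have hd1 : ContDiffAt ℝ j (fun φ => ((m : ℂ) + 1) * ((Real.cos φ : ℂ) * G φ)) φ :=
        ((contDiff_const.mul (contDiff_ofReal_cos.mul hG)).of_le
          (by exact_mod_cast le_top)).contDiffAt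
      have hd2 : ContDiffAt ℝ j (fun φ => (Real.sin φ : ℂ) * deriv G φ) φ :=
        ((contDiff_ofReal_sin.mul (hcder hG)).of_le (by exact_mod_cast le_top)).contDiffAt
      have hs := iteratedDeriv_add (n := j) hd1 hd2
      have e : G₁ = (fun φ => ((m : ℂ) + 1) * ((Real.cos φ : ℂ) * G φ))
        + (fun φ => (Real.sin φ : ℂ) * deriv G φ) := rfl
      rw [e, hs, iteratedDeriv_const_mul_field]
      refine (norm_add_le _ _).trans ?_
      have b1 := norm_iteratedDeriv_mul_le contDiff_ofReal_cos hG hj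
        (fun i _ x => norm_iteratedDeriv_ofReal_cos_le i x) (fun i hi x => hM i (by omega) x) φ
      have b2 := norm_iteratedDeriv_mul_le contDiff_ofReal_sin (hcder hG) hj
        (fun i _ x => norm_iteratedDeriv_ofReal_sin_le i x) (B := M) (fun i hi x => by
          rw [← iteratedDeriv_succ']; exact hM (i + 1) (by omega) x) φ
      have hn : ‖((m : ℂ) + 1)‖ = m + 1 := by
        rw [← Nat.cast_succ, Complex.norm_natCast]; push_cast; ring
      rw [norm_mul, hn]
      nlinarith

end OscillatoryIntegrals

/-! ### The area formula for injective immersions -/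

section AreaFormula

open Filter Topology Module
open scoped NNReal ENNReal

/-- The hypothesis says that f factors through h by a C-Lipschitz map on h '' s: points with the
same h-value have the same f-value. Stated symmetrically in f and h, it compares a map with its
linearization in both directions without inverting either. -/
lemma euclideanHausdorffMeasure_image_le_of_edist_le {α X Y : Type*} [EMetricSpace X]
    [MeasurableSpace X] [BorelSpace X] [EMetricSpace Y] [MeasurableSpace Y] [BorelSpace Y]
    {f : α → Y} {h : α → X} {s : Set α} {C : ℝ≥0}
    (H : ∀ x ∈ s, ∀ y ∈ s, edist (f x) (f y) ≤ C * edist (h x) (h y)) (d : ℕ) :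
    (μHE[d] : Measure Y) (f '' s) ≤ (C : ℝ≥0∞) ^ d * (μHE[d] : Measure X) (h '' s) := by
  rcases s.eq_empty_or_nonempty with rfl | ⟨x₀, hx₀⟩
  · simp
  classical
  have hinv : ∀ z : X, ∃ x ∈ s, z ∈ h '' s → h x = z := fun z => by
    by_cases hz : z ∈ h '' s
    · obtain ⟨x, hx, hxz⟩ := hz
      exact ⟨x, hx, fun _ => hxz⟩
    · exact ⟨x₀, hx₀, fun h => absurd h hz⟩
  choose k hks hk using hinv
  have hL : LipschitzOnWith C (f ∘ k) (h '' s) := by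
    intro z hz w hw
    have := H _ (hks z) _ (hks w)
    rwa [hk z hz, hk w hw] at this
  have himg : f '' s ⊆ (f ∘ k) '' (h '' s) := by
    rintro _ ⟨x, hx, rfl⟩
    refine ⟨h x, mem_image_of_mem h hx, ?_⟩
    have h1 := H (k (h x)) (hks _) x hx
    rw [hk (h x) (mem_image_of_mem h hx), edist_self, mul_zero] at h1
    exact edist_eq_zero.1 (le_antisymm h1 bot_le)
  have h2 := hL.hausdorffMeasure_image_le (Nat.cast_nonneg d)
  simp only [Measure.euclideanHausdorffMeasure_def, Measure.smul_apply, ENNReal.smul_def,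
    smul_eq_mul]
  rw [mul_left_comm]
  gcongr
  refine (measure_mono himg).trans ?_
  simpa using h2

variable {V W : Type*} [NormedAddCommGroup V] [InnerProductSpace ℝ V] [FiniteDimensional ℝ V]
  [NormedAddCommGroup W] [InnerProductSpace ℝ W]

/-- An injective L in finite dimension is bounded below, so the strict-differentiability error o(|x
− y|) is also o(|L x − L y|). -/
lemma exists_closedBall_edist_le_of_hasStrictFDerivAt {g : V → W} {L : V →L[ℝ] W} {x₀ : V}
    (hg : HasStrictFDerivAt g L x₀) (hL : Function.Injective L) {a : ℝ≥0} (ha : 1 < a) :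
    ∀ᶠ r in 𝓝[>] (0 : ℝ), ∀ x ∈ Metric.closedBall x₀ r, ∀ y ∈ Metric.closedBall x₀ r,
      edist (g x) (g y) ≤ a * edist (L x) (L y) ∧ edist (L x) (L y) ≤ a * edist (g x) (g y) := by
  obtain ⟨K, hK, hanti⟩ := LinearMap.exists_antilipschitzWith (L : V →ₗ[ℝ] W)
    (LinearMap.ker_eq_bot.2 hL)
  have ha' : (1 : ℝ) < a := by exact_mod_cast ha
  have hK' : (0 : ℝ) < K := by exact_mod_cast hK
  -- Chosen so that 1 − ε = 1/a and 1 + ε ≤ a, which are the two comparisons needed.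
  set ε : ℝ := (1 - (a : ℝ)⁻¹) with hε
  have hinv : (a : ℝ)⁻¹ < 1 := inv_lt_one_of_one_lt₀ ha'
  have hε0 : 0 < ε := by linarith
  have hapos : (0 : ℝ) < a := by linarith
  have hεa : 1 + ε ≤ a := by
    have : (a : ℝ) * (a : ℝ)⁻¹ = 1 := mul_inv_cancel₀ hapos.ne'
    nlinarith
  have hev := (hasStrictFDerivAt_iff_isLittleO.1 hg).def (c := ε / K) (by positivity)
  rw [nhds_prod_eq] at hev
  obtain ⟨s, hs, hss⟩ := mem_prod_self_iff.1 hev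
  obtain ⟨ρ, hρ, hρs⟩ := Metric.mem_nhds_iff.1 hs
  filter_upwards [Ioo_mem_nhdsGT hρ] with r hr x hx y hy
  have hx' := hρs (Metric.closedBall_subset_ball hr.2 hx)
  have hy' := hρs (Metric.closedBall_subset_ball hr.2 hy)
  have h1 : ‖g x - g y - L (x - y)‖ ≤ ε / K * ‖x - y‖ := hss (mk_mem_prod hx' hy')
  have h2 : ‖x - y‖ ≤ K * ‖L x - L y‖ := by
    simpa [dist_eq_norm] using hanti.le_mul_dist x y
  have h3 : ‖g x - g y - L (x - y)‖ ≤ ε * ‖L x - L y‖ := by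
    refine h1.trans ((mul_le_mul_of_nonneg_left h2 (by positivity)).trans_eq ?_)
    field_simp
  rw [map_sub] at h3
  have h4 : ‖g x - g y‖ ≤ ‖L x - L y‖ + ‖g x - g y - (L x - L y)‖ := by
    simpa using norm_add_le (L x - L y) (g x - g y - (L x - L y))
  have h5 : ‖L x - L y‖ ≤ ‖g x - g y‖ + ‖g x - g y - (L x - L y)‖ := by
    simpa using norm_sub_le (g x - g y) (g x - g y - (L x - L y))
  have hn := norm_nonneg (L x - L y)
  constructor
  · rw [edist_nndist, edist_nndist]
    norm_cast
    rw [← NNReal.coe_le_coe]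
    simp only [NNReal.coe_mul, coe_nndist, dist_eq_norm]
    nlinarith
  · rw [edist_nndist, edist_nndist]
    norm_cast
    rw [← NNReal.coe_le_coe]
    simp only [NNReal.coe_mul, coe_nndist, dist_eq_norm]
    have : (a : ℝ)⁻¹ * ‖L x - L y‖ ≤ ‖g x - g y‖ := by
      have : (a : ℝ)⁻¹ = 1 - ε := by rw [hε]; ring
      rw [this]; linarith
    rwa [inv_mul_le_iff₀ hapos] at this

lemma le_of_forall_one_lt_le_pow_mul {A B : ℝ≥0∞} (hB : B ≠ ⊤) (n : ℕ)
    (h : ∀ a : ℝ≥0, 1 < a → A ≤ (a : ℝ≥0∞) ^ n * B) : A ≤ B := by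
  have ht : Tendsto (fun a : ℝ≥0 => ((a ^ n : ℝ≥0) : ℝ≥0∞) * B) (𝓝[>] 1)
      (𝓝 (((1 ^ n : ℝ≥0) : ℝ≥0∞) * B)) := by
    refine ENNReal.Tendsto.mul_const ?_ (Or.inr hB)
    refine ENNReal.tendsto_coe.2 ?_
    exact ((continuous_pow n).tendsto 1).mono_left nhdsWithin_le_nhds
  have : NeBot (𝓝[>] (1 : ℝ≥0)) := nhdsGT_neBot 1
  have := ge_of_tendsto ht (by
    filter_upwards [self_mem_nhdsWithin] with a ha
    simpa using h a ha)
  simpa using this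

variable [MeasurableSpace V] [BorelSpace V] [MeasurableSpace W]
  [BorelSpace W]

/-- **Area formula**: the Hausdorff measure of the image of an injective immersion. -/
theorem comap_euclideanHausdorffMeasure_eq_withDensity {g : V → W} {g' : V → V →L[ℝ] W}
    (hg : ∀ x, HasStrictFDerivAt g (g' x) x) (hinj : Function.Injective g)
    (hinj' : ∀ x, Function.Injective (g' x)) {K : ℝ≥0} (hK : LipschitzWith K g) :
    (μHE[finrank ℝ V] : Measure W).comap g =
      volume.withDensity (fun x => ENNReal.ofReal (g' x).toLinearMap.normDet) := by
  have hemb : MeasurableEmbedding g := hK.continuous.measurableEmbedding hinj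
  set n := finrank ℝ V with hn
  set ν : Measure V := (μHE[n] : Measure W).comap g with hν
  have hνs : ∀ s, ν s = (μHE[n] : Measure W) (g '' s) := fun s => hemb.comap_apply _ s
  have hvol : (μHE[n] : Measure V) = volume := InnerProductSpace.euclideanHausdorffMeasure_eq_volume
  -- The Lipschitz bound makes the pulled-back measure absolutely continuous and locally finite, so
  -- it is determined by its density.
  have hbound : ∀ s, ν s ≤ (K : ℝ≥0∞) ^ n * volume s := fun s => by
    have := euclideanHausdorffMeasure_image_le_of_edist_le (f := g) (h := (id : V → V)) (s := s)
      (C := K) (fun x _ y _ => hK x y) n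
    rwa [image_id, hvol, ← hνs] at this
  have hac : ν ≪ volume := by
    refine Measure.AbsolutelyContinuous.mk fun s _ h0 => ?_
    have := hbound s
    rw [h0, mul_zero] at this
    exact le_antisymm this bot_le
  have hlf : IsLocallyFiniteMeasure ν := ⟨fun x => ⟨Metric.ball x 1, Metric.ball_mem_nhds x one_pos,
    (hbound _).trans_lt (ENNReal.mul_lt_top (ENNReal.pow_lt_top ENNReal.coe_lt_top)
      measure_ball_lt_top)⟩⟩
  rw [← Measure.withDensity_rnDeriv_eq ν volume hac]
  refine withDensity_congr_ae ?_
  -- The density is almost everywhere the limit of ratios of measures of small balls. For each a > 1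
  -- such a ball has image measure within a factor a^n of that of its image under `g' x`, which is
  -- governed by `normDet`; then a tends to 1.
  filter_upwards [Besicovitch.ae_tendsto_rnDeriv ν (volume : Measure V),
    Measure.rnDeriv_lt_top ν (volume : Measure V)] with x hx hfin
  have himg : ∀ s, (μHE[n] : Measure W) (g' x '' s)
      = ENNReal.ofReal (g' x).toLinearMap.normDet * volume s := fun s =>
    (g' x).toLinearMap.euclideanHausdorffMeasure_image_eq_normDet_mul_volume s
  have hballpos : ∀ r ∈ Ioi (0 : ℝ), volume (Metric.closedBall x r) ≠ 0 := fun r hr =>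
    (Metric.measure_closedBall_pos volume x hr).ne'
  have hballtop : ∀ r, volume (Metric.closedBall x r) ≠ ⊤ := fun r =>
    measure_closedBall_lt_top.ne
  apply le_antisymm
  · refine le_of_forall_one_lt_le_pow_mul ENNReal.ofReal_ne_top n fun a ha => ?_
    refine le_of_tendsto hx ?_
    filter_upwards [exists_closedBall_edist_le_of_hasStrictFDerivAt (hg x) (hinj' x) ha,
      self_mem_nhdsWithin] with r hr hr0
    rw [ENNReal.div_le_iff (hballpos r hr0) (hballtop r), hνs, mul_assoc, ← himg]
    exact euclideanHausdorffMeasure_image_le_of_edist_le (fun y hy z hz => (hr y hy z hz).1) n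
  · refine le_of_forall_one_lt_le_pow_mul hfin.ne n fun a ha => ?_
    have ht := ENNReal.Tendsto.const_mul (a := ((a : ℝ≥0∞) ^ n)) hx
      (Or.inr (ENNReal.pow_ne_top ENNReal.coe_ne_top))
    refine ge_of_tendsto ht ?_
    filter_upwards [exists_closedBall_edist_le_of_hasStrictFDerivAt (hg x) (hinj' x) ha,
      self_mem_nhdsWithin] with r hr hr0
    rw [← mul_div_assoc, ENNReal.le_div_iff_mul_le (Or.inl (hballpos r hr0))
      (Or.inl (hballtop r)), hνs, ← himg]
    exact euclideanHausdorffMeasure_image_le_of_edist_le (fun y hy z hz => (hr y hy z hz).2) n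

end AreaFormula

/-! ### Support points of convex sets -/

section SupportPoints

open Filter Topology Module
open scoped RealInnerProductSpace

/-- `p` is a point of `K` at which `⟪·, u⟫` is maximal. -/
def IsSupportPoint {F : Type*} [NormedAddCommGroup F] [InnerProductSpace ℝ F]
    (K : Set F) (u p : F) : Prop := p ∈ K ∧ ∀ z ∈ K, ⟪z, u⟫ ≤ ⟪p, u⟫

/-- `y u` is a point of `K` with outer normal `u`, depending smoothly on `u ≠ 0`. -/
structure IsSmoothSupportMap {F : Type*} [NormedAddCommGroup F] [InnerProductSpace ℝ F]
    (K : Set F) (y : F → F) : Prop where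
  isSupportPoint : ∀ u, u ≠ 0 → IsSupportPoint K u (y u)
  contDiffOn : ContDiffOn ℝ ∞ y {0}ᶜ

lemma IsSupportPoint.mem_frontier {F : Type*} [NormedAddCommGroup F] [InnerProductSpace ℝ F]
    {K : Set F} {u p : F} (hu : u ≠ 0) (hp : IsSupportPoint K u p) : p ∈ frontier K := by
  refine ⟨subset_closure hp.1, fun hint => ?_⟩
  have hc : Tendsto (fun s : ℝ => p + s • u) (𝓝[>] 0) (𝓝 p) := by
    have : Continuous fun s : ℝ => p + s • u := by fun_prop
    simpa using (this.tendsto 0).mono_left nhdsWithin_le_nhds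
  obtain ⟨s, hs, hs0⟩ := ((hc.eventually (mem_interior_iff_mem_nhds.1 hint)).and
    self_mem_nhdsWithin).exists
  have := hp.2 _ hs
  rw [inner_add_left, inner_smul_left, real_inner_self_eq_norm_sq] at this
  have h2 : 0 < s * ‖u‖ ^ 2 := mul_pos hs0 (pow_pos (norm_pos_iff.2 hu) 2)
  have h3 : s * ‖u‖ ^ 2 ≤ 0 := by simpa using this
  linarith

/-- A one-sided version is required because it is applied at an endpoint of a segment. -/
lemma hasDerivWithinAt_eq_zero_of_eqOn_zero {f : ℝ → ℝ} {f' δ s : ℝ}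
    (hf : ∀ x ∈ Ico 0 δ, f x = 0) (hs : s ∈ Ico 0 δ) (h : HasDerivAt f f' s) : f' = 0 := by
  have h1 : HasDerivWithinAt f f' (Ici s) s := h.hasDerivWithinAt
  have h2 : HasDerivWithinAt f 0 (Ici s) s := by
    refine (hasDerivWithinAt_const s (Ici s) (0 : ℝ)).congr_of_eventuallyEq ?_ (hf s hs)
    filter_upwards [Ico_mem_nhdsGE hs.2] with x hx
    exact hf x ⟨hs.1.trans hx.1, hx.2⟩
  exact (uniqueDiffWithinAt_Ici s).eq_deriv _ h1 h2

variable {d : ℕ} {K : Set (E d)} {ρ : E d → ℝ} {x : E d}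

/-- If ρ were negative at p, continuity would put a neighbourhood of p inside K. -/
lemma IsLocalDefiningFunction.eventually_eq_zero (hK : IsClosed K)
    (h : IsLocalDefiningFunction K x ρ) : ∀ᶠ p in 𝓝 x, p ∈ frontier K → ρ p = 0 := by
  filter_upwards [h.mem_iff.eventually_nhds] with p hp hfr
  have hle : ρ p ≤ 0 := hp.self_of_nhds.1 (hK.frontier_subset hfr)
  by_contra hne
  refine hfr.2 (mem_interior_iff_mem_nhds.2 ?_)
  filter_upwards [hp, h.smooth.continuous.continuousAt.eventually_lt continuousAt_const
    (lt_of_le_of_ne hle hne)] with z hz hz'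
  exact hz.2 hz'.le

/-- Two support points for the same normal would span a segment of support points, hence of boundary
points. Then ρ vanishes along it near p, so its first and second derivatives in that direction
vanish at p, against positive curvature. -/
lemma eq_of_isSupportPoint (hK : IsCompact K) (hconv : Convex ℝ K)
    (hρ : ∀ x ∈ frontier K, ∃ ρ : E d → ℝ, IsLocalDefiningFunction K x ρ ∧
        ∀ v : E d, v ≠ 0 → fderiv ℝ ρ x v = 0 → 0 < fderiv ℝ (fderiv ℝ ρ) x v v)
    {u p q : E d} (hu : u ≠ 0) (hp : IsSupportPoint K u p) (hq : IsSupportPoint K u q) : p = q := by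
  by_contra hne
  obtain ⟨ρ, h, hcurv⟩ := hρ p (hp.mem_frontier hu)
  set v := q - p with hv
  have hv0 : v ≠ 0 := sub_ne_zero.2 (Ne.symm hne)
  have hpq : ⟪p, u⟫ = ⟪q, u⟫ := le_antisymm (hq.2 p hp.1) (hp.2 q hq.1)
  have hseg : ∀ s ∈ Icc (0 : ℝ) 1, p + s • v ∈ frontier K := fun s hs => by
    refine IsSupportPoint.mem_frontier hu ⟨hconv.add_smul_sub_mem hp.1 hq.1 hs, fun z hz => ?_⟩
    have : ⟪p + s • v, u⟫ = ⟪p, u⟫ := by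
      rw [inner_add_left, inner_smul_left, hv, inner_sub_left, hpq]; simp
    rw [this]; exact hp.2 z hz
  have hline : ∀ s : ℝ, HasDerivAt (fun s : ℝ => p + s • v) v s := fun s => by
    simpa using ((hasDerivAt_id s).smul_const v).const_add p
  have hc : Tendsto (fun s : ℝ => p + s • v) (𝓝 0) (𝓝 p) := by
    have := (hline 0).continuousAt.tendsto
    simpa using this
  obtain ⟨δ, hδ, hball⟩ := Metric.eventually_nhds_iff.1
    (hc.eventually (h.eventually_eq_zero hK.isClosed))
  have hd1 : ∀ s : ℝ, HasDerivAt (fun s : ℝ => ρ (p + s • v)) (fderiv ℝ ρ (p + s • v) v) s :=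
    fun s => ((h.smooth.differentiable (by simp) _).hasFDerivAt).comp_hasDerivAt s (hline s)
  have hρ' : ContDiff ℝ ∞ (fderiv ℝ ρ) := h.smooth.fderiv_right (by simp)
  have hd2 : HasDerivAt (fun s : ℝ => fderiv ℝ ρ (p + s • v) v)
      (fderiv ℝ (fderiv ℝ ρ) p v v) 0 := by
    have h0 : p + (0 : ℝ) • v = p := by simp
    have := ((hρ'.differentiable (by simp) (p + (0 : ℝ) • v)).hasFDerivAt).comp_hasDerivAt 0
      (hline 0)
    have h2 := this.clm_apply (hasDerivAt_const (0 : ℝ) v)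
    simpa [h0] using h2
  have hz0 : ∀ s ∈ Ico 0 (min δ 1), ρ (p + s • v) = 0 := fun s hs =>
    hball (by simpa [abs_of_nonneg hs.1] using hs.2.trans_le (min_le_left _ _))
      (hseg s ⟨hs.1, (hs.2.trans_le (min_le_right _ _)).le⟩)
  have hz1 : ∀ s ∈ Ico 0 (min δ 1), fderiv ℝ ρ (p + s • v) v = 0 := fun s hs =>
    hasDerivWithinAt_eq_zero_of_eqOn_zero hz0 hs (hd1 s)
  have h0 : (0 : ℝ) ∈ Ico 0 (min δ 1) := ⟨le_rfl, by positivity⟩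
  have hz2 := hasDerivWithinAt_eq_zero_of_eqOn_zero hz1 h0 hd2
  have := hcurv v hv0 (by simpa using hz1 0 h0)
  linarith

/-- Lagrange multiplier at a support point. -/
lemma innerSL_eq_smul_fderiv (hρ : Differentiable ℝ ρ) {u p w : E d}
    (hmem : ∀ᶠ z in 𝓝 p, z ∈ K ↔ ρ z ≤ 0) (hp0 : ρ p = 0) (hw : fderiv ℝ ρ p w ≠ 0)
    (hp : IsSupportPoint K u p) :
    innerSL ℝ u = (⟪w, u⟫ / fderiv ℝ ρ p w) • fderiv ℝ ρ p := by
  -- A direction with dρ(v) < 0 points into K, where the linear functional cannot exceed its value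
  -- at p.
  have hdir : ∀ v, fderiv ℝ ρ p v < 0 → ⟪v, u⟫ ≤ 0 := by
    intro v hv
    have hline : HasDerivAt (fun s : ℝ => p + s • v) v 0 := by
      simpa using ((hasDerivAt_id (0 : ℝ)).smul_const v).const_add p
    have hd : HasDerivAt (fun s : ℝ => ρ (p + s • v)) (fderiv ℝ ρ p v) 0 := by
      have := ((hρ (p + (0 : ℝ) • v)).hasFDerivAt).comp_hasDerivAt 0 hline
      simpa [Function.comp_def] using this
    have hc : Tendsto (fun s : ℝ => p + s • v) (𝓝[>] 0) (𝓝 p) := by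
      simpa using hline.continuousAt.tendsto.mono_left nhdsWithin_le_nhds
    have hneg : ∀ᶠ s in 𝓝[>] (0 : ℝ), ρ (p + s • v) < 0 := by
      have := hd.tendsto_slope_zero_right
      filter_upwards [this.eventually_lt_const hv, self_mem_nhdsWithin] with s hs hs0
      simp only [zero_add, zero_smul, add_zero, hp0, sub_zero, smul_eq_mul] at hs
      have hs0' : (0 : ℝ) < s⁻¹ := inv_pos.2 hs0
      by_contra hcon
      exact absurd hs (not_lt.2 (mul_nonneg hs0'.le (not_lt.1 hcon)))
    obtain ⟨s, hs1, hs2, hs0⟩ := (hneg.and ((hc.eventually hmem).and self_mem_nhdsWithin)).exists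
    have := hp.2 _ (hs2.2 hs1.le)
    rw [inner_add_left, inner_smul_left] at this
    have h3 : s * ⟪v, u⟫ ≤ 0 := by simpa using this
    by_contra hcon
    exact absurd h3 (not_le.2 (mul_pos hs0 (not_le.1 hcon)))
  set w' := (fderiv ℝ ρ p w)⁻¹ • w with hw'
  have hw1 : fderiv ℝ ρ p w' = 1 := by simp [hw', hw]
  -- A tangent vector v is the limit of the inward vectors v − s w' as s ↓ 0; applying this to −v as
  -- well gives equality.
  have hker : ∀ v, fderiv ℝ ρ p v = 0 → ⟪v, u⟫ ≤ 0 := by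
    intro v hv
    have hlim : Tendsto (fun s : ℝ => ⟪v - s • w', u⟫) (𝓝[>] 0) (𝓝 ⟪v, u⟫) := by
      have : Continuous fun s : ℝ => ⟪v - s • w', u⟫ := by fun_prop
      simpa using (this.tendsto 0).mono_left nhdsWithin_le_nhds
    refine le_of_tendsto hlim ?_
    filter_upwards [self_mem_nhdsWithin] with s hs
    exact hdir _ (by simpa [hv, hw1] using hs)
  have hker' : ∀ v, fderiv ℝ ρ p v = 0 → ⟪v, u⟫ = 0 := fun v hv => by
    have h1 := hker v hv
    have h2 := hker (-v) (by simp [hv])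
    rw [inner_neg_left] at h2
    linarith
  ext z
  have := hker' (z - fderiv ℝ ρ p z • w') (by simp [hw1])
  rw [inner_sub_left, sub_eq_zero] at this
  rw [innerSL_apply_apply, real_inner_comm, this]
  simp only [hw', inner_smul_left, smul_apply, smul_eq_mul, conj_trivial]
  field_simp

/-- By compactness it suffices to identify cluster points, and the support inequalities pass to the
limit. -/
lemma tendsto_supportPoint (hK : IsCompact K) {y : E d → E d}
    (hy : ∀ u, u ≠ 0 → IsSupportPoint K u (y u)) {u₀ : E d} (hu₀ : u₀ ≠ 0)
    (huniq : ∀ p, IsSupportPoint K u₀ p → p = y u₀) : Tendsto y (𝓝 u₀) (𝓝 (y u₀)) := by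
  have hev : ∀ᶠ u in 𝓝 u₀, u ≠ 0 := isOpen_ne.mem_nhds hu₀
  refine hK.tendsto_nhds_of_unique_mapClusterPt (hev.mono fun u hu => (hy u hu).1)
    fun p hpK hp => huniq p ⟨hpK, fun z hz => ?_⟩
  obtain ⟨U, hU, hlim⟩ := mapClusterPt_iff_ultrafilter.1 hp
  have hid : Tendsto (fun u : E d => u) U (𝓝 u₀) := hU
  refine le_of_tendsto_of_tendsto (tendsto_const_nhds.inner hid) (hlim.inner hid) ?_
  filter_upwards [hU hev] with u hu
  exact (hy u hu).2 z hz

/-- The pair (y u, μ u) solves μ dρ(p) = ⟨u, ·⟩, ρ(p) = 0. The derivative of this system in (p, μ)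
is a bordered Hessian, invertible because D²ρ is positive on the tangent space and μ ≠ 0. The
inverse function theorem then gives smoothness; continuity of y at u₀ ensures that (y u, μ u) stays
on the local branch. -/
lemma contDiffAt_supportPoint (hK : IsCompact K) {y : E d → E d}
    (hy : ∀ u, u ≠ 0 → IsSupportPoint K u (y u)) {u₀ : E d} (hu₀ : u₀ ≠ 0)
    (hlim : Tendsto y (𝓝 u₀) (𝓝 (y u₀))) (h : IsLocalDefiningFunction K (y u₀) ρ)
    (hcurv : ∀ v : E d, v ≠ 0 → fderiv ℝ ρ (y u₀) v = 0 →
      0 < fderiv ℝ (fderiv ℝ ρ) (y u₀) v v) : ContDiffAt ℝ ∞ y u₀ := by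
  set p₀ := y u₀ with hp₀
  have hρd : Differentiable ℝ ρ := h.smooth.differentiable (by simp)
  have hρ' : ContDiff ℝ ∞ (fderiv ℝ ρ) := h.smooth.fderiv_right (by simp)
  obtain ⟨w, hw⟩ : ∃ w, fderiv ℝ ρ p₀ w ≠ 0 := by
    by_contra! hcon
    exact h.fderiv_ne_zero (ContinuousLinearMap.ext hcon)
  have hev : ∀ᶠ u in 𝓝 u₀, u ≠ 0 := isOpen_ne.mem_nhds hu₀
  have hwc : ContinuousAt (fun p => fderiv ℝ ρ p w) p₀ :=
    (hρ'.continuous.clm_apply continuous_const).continuousAt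
  -- The multiplier, read off by testing against the fixed transversal vector w; this formula shows
  -- its continuity at u₀.
  set μ : E d → ℝ := fun u => ⟪w, u⟫ / fderiv ℝ ρ (y u) w with hμ
  have hμlim : Tendsto μ (𝓝 u₀) (𝓝 (μ u₀)) := by
    refine Tendsto.div (tendsto_const_nhds.inner tendsto_id) (hwc.tendsto.comp hlim) hw
  set Φ : E d × ℝ → (E d →L[ℝ] ℝ) × ℝ := fun z => (z.2 • fderiv ℝ ρ z.1, ρ z.1) with hΦ
  have hΦs : ContDiff ℝ ∞ Φ :=
    (contDiff_snd.smul (hρ'.comp contDiff_fst)).prodMk (h.smooth.comp contDiff_fst)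
  have heq : ∀ᶠ u in 𝓝 u₀, Φ (y u, μ u) = (innerSL ℝ u, 0) := by
    filter_upwards [hev, hlim.eventually h.mem_iff.eventually_nhds,
      hlim.eventually (h.eventually_eq_zero hK.isClosed),
      hlim.eventually (hwc.eventually_ne hw)] with u hu h1 h2 h3
    have h0 := h2 ((hy u hu).mem_frontier hu)
    simp only [hΦ, h0]
    rw [innerSL_eq_smul_fderiv hρd h1 h0 h3 (hy u hu)]
  have heq₀ := heq.self_of_nhds
  have hμ0 : μ u₀ ≠ 0 := by
    intro h0
    have := congrArg Prod.fst heq₀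
    simp only [hΦ, h0, zero_smul] at this
    have h2 := congrArg (fun L => L u₀) this
    simp at h2
    exact hu₀ (norm_eq_zero.1 (pow_eq_zero_iff two_ne_zero |>.1 h2.symm))
  have hD : HasFDerivAt Φ ((μ u₀ • (fderiv ℝ (fderiv ℝ ρ) p₀ ∘L ContinuousLinearMap.fst ℝ (E d) ℝ)
      + (ContinuousLinearMap.snd ℝ (E d) ℝ).smulRight (fderiv ℝ ρ p₀)).prod
      (fderiv ℝ ρ p₀ ∘L ContinuousLinearMap.fst ℝ (E d) ℝ)) (p₀, μ u₀) := by
    have hf1 : HasFDerivAt (fun z : E d × ℝ => fderiv ℝ ρ z.1)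
        (fderiv ℝ (fderiv ℝ ρ) p₀ ∘L ContinuousLinearMap.fst ℝ (E d) ℝ) (p₀, μ u₀) :=
      (hρ'.differentiable (by simp) p₀).hasFDerivAt.comp (p₀, μ u₀) hasFDerivAt_fst
    have hf2 : HasFDerivAt (fun z : E d × ℝ => ρ z.1)
        (fderiv ℝ ρ p₀ ∘L ContinuousLinearMap.fst ℝ (E d) ℝ) (p₀, μ u₀) :=
      (hρd p₀).hasFDerivAt.comp (p₀, μ u₀) hasFDerivAt_fst
    exact (hasFDerivAt_snd.smul hf1).prodMk hf2
  set L := ((μ u₀ • (fderiv ℝ (fderiv ℝ ρ) p₀ ∘L ContinuousLinearMap.fst ℝ (E d) ℝ)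
      + (ContinuousLinearMap.snd ℝ (E d) ℝ).smulRight (fderiv ℝ ρ p₀)).prod
      (fderiv ℝ ρ p₀ ∘L ContinuousLinearMap.fst ℝ (E d) ℝ)) with hL
  have hinj : Function.Injective (L : E d × ℝ →ₗ[ℝ] (E d →L[ℝ] ℝ) × ℝ) := by
    rw [← LinearMap.ker_eq_bot, LinearMap.ker_eq_bot']
    rintro ⟨v, s⟩ hz
    have hz1 : μ u₀ • fderiv ℝ (fderiv ℝ ρ) p₀ v + s • fderiv ℝ ρ p₀ = 0 := congrArg Prod.fst hz
    have hz2 : fderiv ℝ ρ p₀ v = 0 := congrArg Prod.snd hz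
    -- Testing the first equation on v removes the dρ term, as v is tangent, and leaves μ D²ρ(v, v)
    -- = 0. Testing on w afterwards gives s = 0.
    have hv : v = 0 := by
      by_contra hv
      have h1 := congrArg (fun T => T v) hz1
      simp [hz2, hμ0] at h1
      exact (hcurv v hv hz2).ne' h1
    have h2 := congrArg (fun T => T w) hz1
    simp [hv, hw] at h2
    simp [hv, h2]
  have hfin : finrank ℝ (E d × ℝ) = finrank ℝ ((E d →L[ℝ] ℝ) × ℝ) := by
    rw [finrank_prod, finrank_prod,
      ← (LinearMap.toContinuousLinearMap : (E d →ₗ[ℝ] ℝ) ≃ₗ[ℝ] (E d →L[ℝ] ℝ)).finrank_eq]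
    congr 1
    exact (Subspace.dual_finrank_eq (K := ℝ) (V := E d)).symm
  set e : (E d × ℝ) ≃L[ℝ] ((E d →L[ℝ] ℝ) × ℝ) :=
    (LinearMap.linearEquivOfInjective _ hinj hfin).toContinuousLinearEquiv with he
  have heL : (e : E d × ℝ →L[ℝ] (E d →L[ℝ] ℝ) × ℝ) = L := by
    ext z <;> simp [he]
  have hD' : HasFDerivAt Φ (e : E d × ℝ →L[ℝ] (E d →L[ℝ] ℝ) × ℝ) (p₀, μ u₀) := heL ▸ hD
  have hinvs := hΦs.contDiffAt.to_localInverse hD' (by simp)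
  have hleft := (hΦs.contDiffAt.hasStrictFDerivAt' hD' (by simp)).eventually_left_inverse
  have hcurve : Tendsto (fun u => (y u, μ u)) (𝓝 u₀) (𝓝 (p₀, μ u₀)) := hlim.prodMk_nhds hμlim
  have hfinal : ∀ᶠ u in 𝓝 u₀,
      y u = (hΦs.contDiffAt.localInverse hD' (by simp) (innerSL ℝ u, 0)).1 := by
    filter_upwards [heq, hcurve.eventually hleft] with u h1 h2
    rw [h1] at h2
    exact (congrArg Prod.fst h2).symm
  have hcomp : ContDiffAt ℝ ∞
      (fun u : E d => (hΦs.contDiffAt.localInverse hD' (by simp) (innerSL ℝ u, 0)).1) u₀ := by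
    refine ContDiffAt.fst ?_
    have : Φ (p₀, μ u₀) = (innerSL ℝ u₀, 0) := heq₀
    rw [this] at hinvs
    refine ContDiffAt.comp u₀ hinvs ?_
    exact ((innerSL ℝ).contDiff.prodMk contDiff_const).contDiffAt
  exact hcomp.congr_of_eventuallyEq hfinal

/-- All that the rest of the proof uses about K: beyond compactness and convexity, curvature enters
only through the smooth map y. -/
theorem IsStrictlyConvexSmooth.exists_isSmoothSupportMap (hK : IsStrictlyConvexSmooth K) :
    K.Nonempty ∧ IsCompact K ∧ Convex ℝ K ∧ ∃ y, IsSmoothSupportMap K y := by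
  rcases hK with ⟨x₀, rfl⟩ | ⟨hne, hc, hconv, hρ⟩
  · refine ⟨singleton_nonempty _, isCompact_singleton, convex_singleton _, fun _ => x₀, ?_, ?_⟩
    · exact fun u _ => ⟨rfl, fun z hz => by rw [mem_singleton_iff.1 hz]⟩
    · exact contDiffOn_const
  · refine ⟨hne, hc, hconv, ?_⟩
    have hex : ∀ u : E d, ∃ p, IsSupportPoint K u p := fun u => by
      obtain ⟨p, hp, hmax⟩ := hc.exists_isMaxOn (f := fun z => ⟪z, u⟫) hne (by fun_prop)
      exact ⟨p, hp, fun z hz => hmax hz⟩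
    choose y hy using hex
    refine ⟨y, fun u _ => hy u, fun u hu => ContDiffAt.contDiffWithinAt ?_⟩
    have hu : u ≠ 0 := hu
    obtain ⟨ρ, h, hcurv⟩ := hρ _ ((hy u).mem_frontier hu)
    exact contDiffAt_supportPoint hc (fun u _ => hy u) hu
      (tendsto_supportPoint hc (fun u _ => hy u) hu
        fun p hp => eq_of_isSupportPoint hc hconv hρ hu hp (hy u)) h hcurv

end SupportPoints

/-! ### ### Consequences of a smooth support map: uniqueness, tangency, the boundary of a parallel
body -/

section SupportMap

open Filter Topology Module
open scoped RealInnerProductSpace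

variable {F : Type*} [NormedAddCommGroup F] [InnerProductSpace ℝ F] {K : Set F} {y : F → F}

namespace IsSmoothSupportMap

lemma contDiffAt (hy : IsSmoothSupportMap K y) {u : F} (hu : u ≠ 0) : ContDiffAt ℝ ∞ y u :=
  hy.contDiffOn.contDiffAt (isOpen_ne.mem_nhds hu)

lemma hasFDerivAt (hy : IsSmoothSupportMap K y) {u : F} (hu : u ≠ 0) :
    HasFDerivAt y (fderiv ℝ y u) u :=
  ((hy.contDiffAt hu).differentiableAt (by simp)).hasFDerivAt

/-- Minty's argument. Adding the support inequalities for p at u and for y at u + s w gives ⟨p − y(u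
+ s w), w⟩ ≤ 0. Let s ↓ 0 and take w = p − y u. Continuity of y at u thus forces uniqueness. -/
lemma eq_of_isSupportPoint (hy : IsSmoothSupportMap K y) {u p : F} (hu : u ≠ 0)
    (hp : IsSupportPoint K u p) : p = y u := by
  have hle : ∀ w, ⟪p - y u, w⟫ ≤ 0 := by
    intro w
    have hcurve : Tendsto (fun s : ℝ => u + s • w) (𝓝[>] 0) (𝓝 u) := by
      have : Continuous fun s : ℝ => u + s • w := by fun_prop
      simpa using (this.tendsto 0).mono_left nhdsWithin_le_nhds
    have hlim : Tendsto (fun s : ℝ => ⟪p - y (u + s • w), w⟫) (𝓝[>] 0) (𝓝 ⟪p - y u, w⟫) :=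
      (tendsto_const_nhds.sub ((hy.contDiffAt hu).continuousAt.tendsto.comp hcurve)).inner
        tendsto_const_nhds
    refine le_of_tendsto hlim ?_
    filter_upwards [self_mem_nhdsWithin, hcurve.eventually (isOpen_ne.mem_nhds hu)] with s hs hne
    have h1 := (hy.isSupportPoint _ hne).2 p hp.1
    have h2 := hp.2 _ (hy.isSupportPoint _ hne).1
    have h3 : s * ⟪p - y (u + s • w), w⟫ ≤ 0 := by
      simp only [inner_add_right, inner_smul_right, inner_sub_left] at h1 ⊢
      linarith
    by_contra hcon
    exact absurd h3 (not_le.2 (mul_pos hs (not_le.1 hcon)))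
  have := hle (p - y u)
  rw [real_inner_self_eq_norm_sq] at this
  have h0 : ‖p - y u‖ = 0 := by nlinarith [norm_nonneg (p - y u)]
  exact sub_eq_zero.1 (norm_eq_zero.1 h0)

/-- With u fixed, z ↦ ⟨y z, u⟩ is maximal at z = u. So Dy(u) takes values in the hyperplane
orthogonal to u, the tangent space shared by all parallel surfaces. -/
lemma inner_fderiv_apply (hy : IsSmoothSupportMap K y) {u : F} (hu : u ≠ 0) (v : F) :
    ⟪fderiv ℝ y u v, u⟫ = 0 := by
  have hmax : IsLocalMax (fun z => ⟪y z, u⟫) u := by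
    filter_upwards [isOpen_ne.mem_nhds hu] with z hz
    exact (hy.isSupportPoint u hu).2 _ (hy.isSupportPoint z hz).1
  have hd : HasFDerivAt (fun z => ⟪u, y z⟫) ((innerSL ℝ u) ∘L fderiv ℝ y u) u :=
    (innerSL ℝ u).hasFDerivAt.comp u (hy.hasFDerivAt hu)
  have h0 : HasFDerivAt (fun z => ⟪y z, u⟫) ((innerSL ℝ u) ∘L fderiv ℝ y u) u := by
    simpa only [real_inner_comm] using hd
  have := congrArg (fun T => T v) (hmax.hasFDerivAt_eq_zero h0)
  rw [real_inner_comm]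
  simpa using this

/-- `θ ↦ y θ + t θ` is injective on the unit sphere. -/
lemma injOn_add_smul (hy : IsSmoothSupportMap K y) {t : ℝ} (ht : 0 < t) :
    InjOn (fun θ => y θ + t • θ) (Metric.sphere 0 1) := by
  intro a ha b hb hab
  have ha0 : a ≠ 0 := fun h => by simp [h] at ha
  have hb0 : b ≠ 0 := fun h => by simp [h] at hb
  have h1 := (hy.isSupportPoint a ha0).2 _ (hy.isSupportPoint b hb0).1
  have h2 := (hy.isSupportPoint b hb0).2 _ (hy.isSupportPoint a ha0).1
  have h3 : y a - y b = t • (b - a) := by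
    have h : y a + t • a = y b + t • b := hab
    rw [smul_sub, sub_eq_sub_iff_add_eq_add, h, add_comm]
  -- Monotonicity of the support map, while `h3` makes this inner product −t|a − b|².
  have h4 : 0 ≤ ⟪y a - y b, a - b⟫ := by
    simp only [inner_sub_left, inner_sub_right]; linarith
  rw [h3, inner_smul_left, ← neg_sub a b, inner_neg_left, real_inner_self_eq_norm_sq] at h4
  have h5 : t * ‖a - b‖ ^ 2 ≤ 0 := by simpa using h4
  have h6 : ‖a - b‖ ^ 2 ≤ 0 := by
    by_contra hcon
    exact absurd h5 (not_le.2 (mul_pos ht (not_le.1 hcon)))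
  have h7 : ‖a - b‖ = 0 := by nlinarith [norm_nonneg (a - b)]
  exact sub_eq_zero.1 (norm_eq_zero.1 h7)

/-- A boundary point x has a nearest point p in K, at distance exactly t, and convexity makes x − p
an outer normal at p. Conversely y θ + tθ is a support point of the sum in direction θ. -/
lemma frontier_add_closedBall [ProperSpace F] (hy : IsSmoothSupportMap K y) (hne : K.Nonempty)
    (hc : IsCompact K) (hconv : Convex ℝ K) {t : ℝ} (ht : 0 < t) :
    frontier (K + Metric.closedBall 0 t) = (fun θ => y θ + t • θ) '' Metric.sphere 0 1 := by
  have hclosed : IsClosed (K + Metric.closedBall (0 : F) t) :=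
    (hc.add (isCompact_closedBall _ _)).isClosed
  ext x
  constructor
  · rintro ⟨hxc, hxi⟩
    rw [hclosed.closure_eq] at hxc
    obtain ⟨p, hp, hdist⟩ := hc.exists_infDist_eq_dist hne x
    have hmin : ∀ z ∈ K, ‖x - p‖ ≤ ‖x - z‖ := fun z hz => by
      rw [← dist_eq_norm, ← dist_eq_norm, ← hdist]
      exact Metric.infDist_le_dist_of_mem hz
    have hle : ‖x - p‖ ≤ t := by
      obtain ⟨z, hz, b, hb, rfl⟩ := hxc
      refine (hmin z hz).trans ?_
      simpa using hb
    -- Otherwise x lies in the open ball of radius t about p, which is inside the sum.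
    have hge : t ≤ ‖x - p‖ := by
      by_contra! hlt
      refine hxi (mem_interior.2 ⟨p +ᵥ Metric.ball (0 : F) t, ?_, ?_, ?_⟩)
      · rintro _ ⟨b, hb, rfl⟩
        exact add_mem_add hp (Metric.ball_subset_closedBall hb)
      · exact Metric.isOpen_ball.vadd p
      · exact ⟨x - p, by simpa using hlt, by simp⟩
    have heq : ‖x - p‖ = t := le_antisymm hle hge
    have : Nonempty K := ⟨⟨p, hp⟩⟩
    have hinf : ‖x - p‖ = ⨅ w : K, ‖x - w‖ :=
      le_antisymm (le_ciInf fun z => hmin z z.2)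
        (ciInf_le ⟨0, by rintro _ ⟨z, rfl⟩; exact norm_nonneg _⟩ (⟨p, hp⟩ : K))
    have hproj := (norm_eq_iInf_iff_real_inner_le_zero hconv hp).1 hinf
    have hxp : x - p ≠ 0 := fun h => by rw [h, norm_zero] at heq; exact ht.ne heq
    set θ := t⁻¹ • (x - p) with hθ
    have hθn : ‖θ‖ = 1 := by
      rw [hθ, norm_smul, heq, norm_inv, Real.norm_of_nonneg ht.le, inv_mul_cancel₀ ht.ne']
    have hθ0 : θ ≠ 0 := fun h => by rw [h, norm_zero] at hθn; exact zero_ne_one hθn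
    have hsup : IsSupportPoint K θ p := ⟨hp, fun z hz => by
      have := hproj z hz
      rw [real_inner_comm, inner_sub_left] at this
      rw [hθ, inner_smul_right, inner_smul_right]
      exact mul_le_mul_of_nonneg_left (by linarith) (inv_nonneg.2 ht.le)⟩
    refine ⟨θ, by simpa using hθn, ?_⟩
    simp only
    rw [← hy.eq_of_isSupportPoint hθ0 hsup, hθ, smul_smul, mul_inv_cancel₀ ht.ne', one_smul]
    abel
  · rintro ⟨θ, hθ, rfl⟩
    have hθn : ‖θ‖ = 1 := by simpa using hθ
    have hθ0 : θ ≠ 0 := fun h => by rw [h, norm_zero] at hθn; exact zero_ne_one hθn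
    have hs := hy.isSupportPoint θ hθ0
    refine IsSupportPoint.mem_frontier hθ0 ⟨add_mem_add hs.1 ?_, ?_⟩
    · simp [norm_smul, hθn, abs_of_pos ht]
    · rintro _ ⟨z, hz, b, hb, rfl⟩
      have h1 := hs.2 z hz
      have h2 : ⟪b, θ⟫ ≤ t := by
        refine (real_inner_le_norm b θ).trans ?_
        rw [hθn, mul_one]; simpa using hb
      simp only [inner_add_left, inner_smul_left, real_inner_self_eq_norm_sq, hθn]
      simp
      linarith

end IsSmoothSupportMap

end SupportMap

/-! ### Stereographic coordinates on the unit sphere -/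

section Stereographic

open Filter Topology Module
open scoped RealInnerProductSpace

variable {V F : Type*} [NormedAddCommGroup V]

/-- The conformal factor of `stereo`. -/
def stereoFactor (w : V) : ℝ := 2 * (1 + ‖w‖ ^ 2)⁻¹

lemma stereoFactor_pos (w : V) : 0 < stereoFactor w := by unfold stereoFactor; positivity

lemma stereoFactor_le (w : V) : stereoFactor w ≤ 2 := by
  have : (1 + ‖w‖ ^ 2)⁻¹ ≤ 1 := inv_le_one_of_one_le₀ (by nlinarith [sq_nonneg ‖w‖])
  unfold stereoFactor; linarith

lemma continuous_stereoFactor : Continuous (stereoFactor : V → ℝ) := by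
  unfold stereoFactor
  exact continuous_const.mul (Continuous.inv₀ (by fun_prop) fun w => by positivity)

variable [InnerProductSpace ℝ V] [NormedAddCommGroup F] [InnerProductSpace ℝ F]

/-- `U` identifies `V` isometrically with the orthogonal complement of the unit vector `e`. -/
structure IsPoleFrame (e : F) (U : V →ₗᵢ[ℝ] F) : Prop where
  norm_pole : ‖e‖ = 1
  inner_pole : ∀ w, ⟪U w, e⟫ = 0
  exists_eq : ∀ x, ⟪x, e⟫ = 0 → ∃ w, U w = x

/-- Inverse of the stereographic projection with pole `e`. -/
def stereo (e : F) (U : V →ₗᵢ[ℝ] F) (w : V) : F :=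
  (1 + ‖w‖ ^ 2)⁻¹ • ((2 : ℝ) • U w + (‖w‖ ^ 2 - 1) • e)

variable {e : F} {U : V →ₗᵢ[ℝ] F}

namespace IsPoleFrame

lemma inner_pole' (h : IsPoleFrame e U) (w : V) : ⟪e, U w⟫ = 0 := by
  rw [real_inner_comm]; exact h.inner_pole w

lemma inner_self_pole (h : IsPoleFrame e U) : ⟪e, e⟫ = 1 := by
  rw [real_inner_self_eq_norm_sq, h.norm_pole]; norm_num

lemma norm_stereo (h : IsPoleFrame e U) (w : V) : ‖stereo e U w‖ = 1 := by
  have h1 : ‖stereo e U w‖ ^ 2 = 1 := by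
    rw [← real_inner_self_eq_norm_sq, stereo]
    simp only [inner_add_left, inner_add_right, inner_smul_left, inner_smul_right,
      h.inner_pole, h.inner_pole', h.inner_self_pole, U.inner_map_map,
      real_inner_self_eq_norm_sq, conj_trivial]
    field_simp
    ring
  nlinarith [norm_nonneg (stereo e U w)]

lemma stereo_ne_zero (h : IsPoleFrame e U) (w : V) : stereo e U w ≠ 0 := fun h0 => by
  have := h.norm_stereo w
  rw [h0, norm_zero] at this
  exact zero_ne_one this

lemma inner_stereo_pole (h : IsPoleFrame e U) (w : V) :
    ⟪stereo e U w, e⟫ = 1 - stereoFactor w := by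
  rw [stereo, stereoFactor]
  simp only [inner_add_left, inner_smul_left, h.inner_pole, h.inner_self_pole, conj_trivial]
  field_simp
  ring

lemma injective_stereo (h : IsPoleFrame e U) : Function.Injective (stereo e U) := by
  intro a b hab
  have h1 : stereoFactor a = stereoFactor b := by
    have := congrArg (fun x => ⟪x, e⟫) hab
    simp only [h.inner_stereo_pole] at this
    linarith
  have h2 : ‖a‖ ^ 2 = ‖b‖ ^ 2 := by
    have := inv_injective (mul_left_cancel₀ two_ne_zero h1)
    linarith
  have h3 : (1 + ‖b‖ ^ 2)⁻¹ ≠ 0 := by positivity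
  rw [stereo, stereo, h2] at hab
  have h4 := smul_right_injective F h3 hab
  have h5 : (2 : ℝ) • U a = (2 : ℝ) • U b := add_right_cancel h4
  exact U.injective (smul_right_injective F two_ne_zero h5)

lemma range_stereo (h : IsPoleFrame e U) : range (stereo e U) = Metric.sphere 0 1 \ {e} := by
  ext x
  constructor
  · rintro ⟨w, rfl⟩
    refine ⟨by simpa using h.norm_stereo w, fun hx => ?_⟩
    have := h.inner_stereo_pole w
    rw [mem_singleton_iff.1 hx, h.inner_self_pole] at this
    have := stereoFactor_pos w
    linarith
  · rintro ⟨hx, hne⟩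
    have hx1 : ‖x‖ = 1 := by simpa using hx
    set a := ⟪x, e⟫ with ha
    have ha1 : a < 1 := by
      refine lt_of_le_of_ne ?_ fun h1 => hne ?_
      · have := real_inner_le_norm x e
        rwa [hx1, h.norm_pole, mul_one] at this
      · exact (inner_eq_one_iff_of_norm_eq_one hx1 h.norm_pole).1 h1
    obtain ⟨v, hv⟩ := h.exists_eq (x - a • e) (by
      rw [inner_sub_left, inner_smul_left, h.inner_self_pole]; simp [ha])
    have hvn : ‖v‖ ^ 2 = 1 - a ^ 2 := by
      rw [← U.norm_map, hv, ← real_inner_self_eq_norm_sq]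
      simp only [inner_sub_left, inner_sub_right, inner_smul_left, inner_smul_right,
        h.inner_self_pole, real_inner_self_eq_norm_sq, hx1, conj_trivial]
      rw [real_inner_comm x e, ← ha]
      ring
    have h1a : 1 - a ≠ 0 := by linarith
    have hw : ‖(1 - a)⁻¹ • v‖ ^ 2 = (1 + a) / (1 - a) := by
      rw [norm_smul, mul_pow, hvn, norm_inv, Real.norm_eq_abs, inv_pow, sq_abs]
      field_simp
      ring
    -- Projection from the pole: the component of x orthogonal to e, divided by 1 − ⟨x, e⟩.
    refine ⟨(1 - a)⁻¹ • v, ?_⟩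
    have h2 : (1 + (1 + a) / (1 - a))⁻¹ = (1 - a) / 2 := by
      field_simp; ring_nf
    have hxe : x = U v + a • e := by rw [hv]; abel
    rw [stereo, hw, h2, map_smul, hxe, smul_add, smul_smul, smul_smul, smul_smul]
    congr 1
    · rw [show (1 - a) / 2 * 2 * (1 - a)⁻¹ = 1 by field_simp, one_smul]
    · congr 1
      field_simp
      ring

end IsPoleFrame

/-- The derivative of `stereo`. -/
def stereoDeriv (e : F) (U : V →ₗᵢ[ℝ] F) (w : V) : V →L[ℝ] F :=
  (1 + ‖w‖ ^ 2)⁻¹ • ((2 : ℝ) • U.toContinuousLinearMap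
      + ((2 : ℝ) • innerSL ℝ w).smulRight e)
    + (-((1 + ‖w‖ ^ 2) ^ 2)⁻¹ • ((2 : ℝ) • innerSL ℝ w)).smulRight
      ((2 : ℝ) • U w + (‖w‖ ^ 2 - 1) • e)

lemma hasFDerivAt_stereo (e : F) (U : V →ₗᵢ[ℝ] F) (w : V) :
    HasFDerivAt (stereo e U) (stereoDeriv e U w) w := by
  have h1 : HasFDerivAt (fun w : V => ‖w‖ ^ 2) ((2 : ℝ) • innerSL ℝ w) w := by
    simpa only [ofNat_smul_eq_nsmul] using (hasStrictFDerivAt_norm_sq w).hasFDerivAt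
  have h2 : HasFDerivAt (fun w : V => (1 + ‖w‖ ^ 2)⁻¹)
      (-((1 + ‖w‖ ^ 2) ^ 2)⁻¹ • ((2 : ℝ) • innerSL ℝ w)) w :=
    (hasDerivAt_inv (by positivity)).comp_hasFDerivAt w (h1.const_add 1)
  have h3 : HasFDerivAt (fun w : V => (2 : ℝ) • U w + (‖w‖ ^ 2 - 1) • e)
      ((2 : ℝ) • U.toContinuousLinearMap + ((2 : ℝ) • innerSL ℝ w).smulRight e) w :=
    (U.toContinuousLinearMap.hasFDerivAt.const_smul (2 : ℝ)).add ((h1.sub_const 1).smul_const e)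
  exact h2.smul h3

lemma contDiff_stereo (e : F) (U : V →ₗᵢ[ℝ] F) : ContDiff ℝ ∞ (stereo e U) := by
  unfold stereo
  refine ContDiff.smul (ContDiff.inv (contDiff_const.add (contDiff_norm_sq ℝ))
    fun w => by positivity) ?_
  exact (U.toContinuousLinearMap.contDiff.const_smul (2 : ℝ)).add
    (((contDiff_norm_sq ℝ).sub contDiff_const).smul contDiff_const)

namespace IsPoleFrame

/-- Conformality: after division by `stereoFactor` the derivative is an isometry, which is what
makes the Jacobian of the chart explicit. -/
lemma norm_stereoDeriv_apply (h : IsPoleFrame e U) (w v : V) :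
    ‖stereoDeriv e U w v‖ = stereoFactor w * ‖v‖ := by
  have h1 : ‖stereoDeriv e U w v‖ ^ 2 = (stereoFactor w * ‖v‖) ^ 2 := by
    rw [← real_inner_self_eq_norm_sq, stereoFactor]
    simp only [stereoDeriv, add_apply, smul_apply, ContinuousLinearMap.smulRight_apply,
      LinearIsometry.coe_toContinuousLinearMap, innerSL_apply_apply, smul_eq_mul,
      inner_add_left, inner_add_right, inner_smul_left, inner_smul_right,
      h.inner_pole, h.inner_pole', h.inner_self_pole, U.inner_map_map,
      real_inner_self_eq_norm_sq, conj_trivial, real_inner_comm v w]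
    field_simp
    ring
  have h2 : 0 ≤ stereoFactor w * ‖v‖ := mul_nonneg (stereoFactor_pos w).le (norm_nonneg v)
  exact (sq_eq_sq₀ (norm_nonneg _) h2).1 h1

lemma inner_stereoDeriv_apply (h : IsPoleFrame e U) (w v : V) :
    ⟪stereoDeriv e U w v, stereo e U w⟫ = 0 := by
  have hconst : HasFDerivAt (fun w => ‖stereo e U w‖ ^ 2) (0 : V →L[ℝ] ℝ) w := by
    simp only [h.norm_stereo]
    exact hasFDerivAt_const _ _
  have h2 := ((hasStrictFDerivAt_norm_sq (stereo e U w)).hasFDerivAt).comp w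
    (hasFDerivAt_stereo e U w)
  have h3 := congrArg (fun T => T v) (h2.unique hconst)
  simp only [ContinuousLinearMap.comp_apply, smul_apply, innerSL_apply_apply] at h3
  rw [real_inner_comm]
  simpa using h3

end IsPoleFrame

end Stereographic

/-! ### Charts of parallel bodies -/

section ParallelChart

open Module
open scoped RealInnerProductSpace

variable {V F : Type*} [NormedAddCommGroup V] [InnerProductSpace ℝ V]
  [NormedAddCommGroup F] [InnerProductSpace ℝ F] {K : Set F} {y : F → F}

lemma IsSmoothSupportMap.continuousOn_fderiv (hy : IsSmoothSupportMap K y) :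
    ContinuousOn (fderiv ℝ y) {0}ᶜ :=
  hy.contDiffOn.continuousOn_fderiv_of_isOpen isOpen_compl_singleton (by simp)

/-- Parametrization of the boundary of a parallel body by stereographic coordinates. -/
def parallelChart (y : F → F) (t : ℝ) (e : F) (U : V →ₗᵢ[ℝ] F) (w : V) : F :=
  y (stereo e U w) + t • stereo e U w

variable {e : F} {U : V →ₗᵢ[ℝ] F}

lemma IsSmoothSupportMap.contDiff_parallelChart (hy : IsSmoothSupportMap K y)
    (h : IsPoleFrame e U) (t : ℝ) : ContDiff ℝ ∞ (parallelChart y t e U) := by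
  rw [contDiff_iff_contDiffAt]
  intro w
  exact ((hy.contDiffAt (h.stereo_ne_zero w)).comp w (contDiff_stereo e U).contDiffAt).add
    ((contDiff_stereo e U).const_smul t).contDiffAt

lemma IsSmoothSupportMap.hasFDerivAt_parallelChart (hy : IsSmoothSupportMap K y)
    (h : IsPoleFrame e U) (t : ℝ) (w : V) :
    HasFDerivAt (parallelChart y t e U)
      ((fderiv ℝ y (stereo e U w) + t • ContinuousLinearMap.id ℝ F) ∘L stereoDeriv e U w) w :=
  ((hy.hasFDerivAt (h.stereo_ne_zero w)).add
    ((hasFDerivAt_id (stereo e U w)).const_smul t)).comp w (hasFDerivAt_stereo e U w)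

end ParallelChart

/-! ### The surface measure of a parallel body in stereographic coordinates -/

section SurfaceMeasure

open Filter Topology Module
open scoped RealInnerProductSpace NNReal ENNReal

/-- Sylvester's identity, used to move a determinant from the coordinate space to the ambient space.
-/
lemma det_one_add_comp_comm {M N : Type*} [AddCommGroup M] [Module ℝ M] [FiniteDimensional ℝ M]
    [AddCommGroup N] [Module ℝ N] [FiniteDimensional ℝ N] (f : M →ₗ[ℝ] N) (g : N →ₗ[ℝ] M) :
    LinearMap.det (1 + g ∘ₗ f) = LinearMap.det (1 + f ∘ₗ g) := by
  set b := finBasis ℝ M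
  set c := finBasis ℝ N
  rw [← LinearMap.det_toMatrix b, ← LinearMap.det_toMatrix c, map_add, map_add,
    LinearMap.toMatrix_comp b c b, LinearMap.toMatrix_comp c b c, LinearMap.toMatrix_one,
    LinearMap.toMatrix_one]
  exact Matrix.det_one_add_mul_comm _ _

variable {V F : Type*} [NormedAddCommGroup V] [InnerProductSpace ℝ V] [FiniteDimensional ℝ V]
  [NormedAddCommGroup F] [InnerProductSpace ℝ F] [FiniteDimensional ℝ F]

/-- The derivative of `stereo` is c W with W an isometry onto the complement of θ. Since A maps into
that complement, W W* A = A, so the composite is tc · W (1 + t⁻¹ W* A W). Sylvester's identity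
replaces the inner determinant by one on F, free of the chosen coordinates. -/
lemma normDet_add_smul_comp_stereoDeriv (hdim : finrank ℝ F = finrank ℝ V + 1) {e : F}
    {U : V →ₗᵢ[ℝ] F} (h : IsPoleFrame e U) (w : V) {A : F →L[ℝ] F}
    (hA : ∀ v, ⟪A v, stereo e U w⟫ = 0) {t : ℝ} (ht : 0 < t) :
    ((A + t • ContinuousLinearMap.id ℝ F) ∘L stereoDeriv e U w).toLinearMap.normDet =
      (t * stereoFactor w) ^ finrank ℝ V *
        |LinearMap.det (1 + t⁻¹ • (A : F →ₗ[ℝ] F))| := by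
  have hc := stereoFactor_pos w
  set c := stereoFactor w with hcdef
  set θ := stereo e U w with hθ
  have hθ0 : θ ≠ 0 := h.stereo_ne_zero w
  let W : V →ₗᵢ[ℝ] F :=
    { toLinearMap := c⁻¹ • (stereoDeriv e U w).toLinearMap
      norm_map' := fun v => by
        have := h.norm_stereoDeriv_apply w v
        simp only [LinearMap.smul_apply, ContinuousLinearMap.coe_coe, norm_smul, this, norm_inv,
          Real.norm_eq_abs, abs_of_pos hc]
        rw [inv_mul_cancel_left₀ hc.ne'] }
  have hW : ∀ v, stereoDeriv e U w v = c • W v := fun v => by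
    change _ = c • (c⁻¹ • stereoDeriv e U w v)
    rw [smul_smul, mul_inv_cancel₀ hc.ne', one_smul]
  have hWθ : ∀ v, ⟪W v, θ⟫ = 0 := fun v => by
    change ⟪c⁻¹ • stereoDeriv e U w v, θ⟫ = 0
    rw [inner_smul_left, h.inner_stereoDeriv_apply w v, mul_zero]
  have hrange : LinearMap.range W.toLinearMap = (Submodule.span ℝ {θ})ᗮ := by
    have : Fact (finrank ℝ F = finrank ℝ V + 1) := ⟨hdim⟩
    refine Submodule.eq_of_le_of_finrank_eq ?_ ?_
    · rintro _ ⟨v, rfl⟩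
      rw [Submodule.mem_orthogonal_singleton_iff_inner_left]
      exact hWθ v
    · rw [LinearMap.finrank_range_of_inj W.injective,
        Submodule.finrank_orthogonal_span_singleton (n := finrank ℝ V) hθ0]
  set W' : F →ₗ[ℝ] V := (ContinuousLinearMap.adjoint W.toContinuousLinearMap).toLinearMap with hW'
  have hW'W : ∀ v, W' (W v) = v := fun v => by
    refine ext_inner_right ℝ fun x => ?_
    rw [hW', ContinuousLinearMap.coe_coe, ContinuousLinearMap.adjoint_inner_left]
    exact W.inner_map_map v x
  have hWW' : ∀ x, ⟪x, θ⟫ = 0 → W (W' x) = x := fun x hx => by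
    have : x ∈ LinearMap.range W.toLinearMap := by
      rw [hrange, Submodule.mem_orthogonal_singleton_iff_inner_left]; exact hx
    obtain ⟨v, rfl⟩ := this
    exact congrArg W (hW'W v)
  set T : V →ₗ[ℝ] V := 1 + (W' ∘ₗ (t⁻¹ • (A : F →ₗ[ℝ] F))) ∘ₗ W.toLinearMap with hT
  have hfac : ((A + t • ContinuousLinearMap.id ℝ F) ∘L stereoDeriv e U w).toLinearMap
      = (t * c) • (W.toLinearMap ∘ₗ T) := by
    ext v
    have h1 : W (W' (A (W v))) = A (W v) := hWW' _ (hA _)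
    simp only [hT, ContinuousLinearMap.coe_coe, ContinuousLinearMap.comp_apply, hW, add_apply,
      smul_apply, ContinuousLinearMap.id_apply, map_smul, LinearMap.smul_apply,
      LinearMap.comp_apply, LinearMap.add_apply, Module.End.one_apply, map_add,
      LinearIsometry.coe_toLinearMap, h1]
    conv_rhs => rw [smul_add, smul_smul (t * c), mul_right_comm, mul_inv_cancel₀ ht.ne', one_mul]
    module
  rw [hfac, LinearMap.normDet_smul, LinearMap.normDet_comp_of_finrank_eq _ _ rfl,
    W.normDet_eq_one, LinearMap.normDet_eq_abs_det, one_mul, Real.norm_of_nonneg (by positivity),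
    hT, det_one_add_comp_comm]
  congr 4
  ext x
  exact hWW' _ (by simp [inner_smul_left, hA])

variable {K : Set F} {y : F → F}

/-- The density of the surface measure of a parallel body in stereographic coordinates. -/
def parallelDensity (y : F → F) (t : ℝ) (e : F) (U : V →ₗᵢ[ℝ] F) (w : V) : ℝ :=
  (t * stereoFactor w) ^ finrank ℝ V *
    |LinearMap.det (1 + t⁻¹ • (fderiv ℝ y (stereo e U w) : F →ₗ[ℝ] F))|

variable {e : F} {U : V →ₗᵢ[ℝ] F}

variable [MeasurableSpace V] [BorelSpace V] [MeasurableSpace F] [BorelSpace F]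

/-- The chart is an injective immersion onto the boundary minus the single point with normal e. That
point is null since the dimension is positive, and the area formula gives the density. -/
theorem IsSmoothSupportMap.restrict_frontier_eq_map (hdim : finrank ℝ F = finrank ℝ V + 1)
    (hV : 0 < finrank ℝ V) (hy : IsSmoothSupportMap K y) (hne : K.Nonempty) (hc : IsCompact K)
    (hconv : Convex ℝ K) (h : IsPoleFrame e U) {t : ℝ} (ht : 0 < t)
    (hdet : ∀ θ ∈ Metric.sphere (0 : F) 1,
      LinearMap.det (1 + t⁻¹ • (fderiv ℝ y θ : F →ₗ[ℝ] F)) ≠ 0) :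
    MeasurableEmbedding (parallelChart y t e U) ∧
    (μHE[finrank ℝ V] : Measure F).restrict (frontier (K + Metric.closedBall 0 t)) =
      (volume.withDensity fun w => ENNReal.ofReal (parallelDensity y t e U w)).map
        (parallelChart y t e U) := by
  set g := parallelChart y t e U with hg
  set g' : V → V →L[ℝ] F := fun w =>
    (fderiv ℝ y (stereo e U w) + t • ContinuousLinearMap.id ℝ F) ∘L stereoDeriv e U w with hg'
  have hgs := hy.contDiff_parallelChart h t
  have hgd : ∀ w, HasFDerivAt g (g' w) w := hy.hasFDerivAt_parallelChart h t
  have hstrict : ∀ w, HasStrictFDerivAt g (g' w) w := fun w =>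
    hgs.contDiffAt.hasStrictFDerivAt' (hgd w) (by simp)
  have hsph : ∀ w, stereo e U w ∈ Metric.sphere (0 : F) 1 := fun w => by
    simpa using h.norm_stereo w
  have hinj : Function.Injective g := fun a b hab =>
    h.injective_stereo (hy.injOn_add_smul ht (hsph a) (hsph b) hab)
  have hnd : ∀ w, (g' w).toLinearMap.normDet = parallelDensity y t e U w := fun w =>
    normDet_add_smul_comp_stereoDeriv hdim h w
      (hy.inner_fderiv_apply (h.stereo_ne_zero w)) ht
  have hinj' : ∀ w, Function.Injective (g' w) := fun w => by
    have hpos : (g' w).toLinearMap.normDet ≠ 0 := by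
      rw [hnd]
      exact mul_ne_zero (pow_ne_zero _ (mul_pos ht (stereoFactor_pos w)).ne')
        (abs_ne_zero.2 (hdet _ (hsph w)))
    exact LinearMap.ker_eq_bot.1 (((g' w).toLinearMap.normDet_ne_zero_tfae.out 0 1).1 hpos)
  have hsub : Metric.sphere (0 : F) 1 ⊆ {0}ᶜ := fun θ hθ h0 => by
    rw [mem_singleton_iff.1 h0] at hθ; simp at hθ
  obtain ⟨M, hM⟩ := (isCompact_sphere (0 : F) 1).exists_bound_of_continuousOn
    (hy.continuousOn_fderiv.mono hsub)
  -- The zero vector of V serves only to produce a point of the sphere.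
  have hM0 : 0 ≤ M := (norm_nonneg _).trans (hM _ (hsph 0))
  have hLip : LipschitzWith (Real.toNNReal ((M + t) * 2)) g := by
    refine lipschitzWith_of_nnnorm_fderiv_le (hgs.differentiable (by simp)) fun w => ?_
    rw [(hgd w).fderiv, ← NNReal.coe_le_coe, coe_nnnorm, Real.coe_toNNReal _ (by positivity)]
    refine (ContinuousLinearMap.opNorm_comp_le _ _).trans ?_
    gcongr
    · refine (norm_add_le _ _).trans (add_le_add (hM _ (hsph w)) ?_)
      rw [norm_smul, Real.norm_of_nonneg ht.le]
      exact mul_le_of_le_one_right ht.le ContinuousLinearMap.norm_id_le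
    · refine ContinuousLinearMap.opNorm_le_bound _ (by norm_num) fun v => ?_
      rw [h.norm_stereoDeriv_apply]
      exact mul_le_mul_of_nonneg_right (stereoFactor_le w) (norm_nonneg v)
  have hemb : MeasurableEmbedding g := hLip.continuous.measurableEmbedding hinj
  refine ⟨hemb, ?_⟩
  have harea := comap_euclideanHausdorffMeasure_eq_withDensity hstrict hinj hinj' hLip
  simp only [hnd] at harea
  rw [← harea, hemb.map_comap]
  refine Measure.restrict_congr_set ?_
  have hfr := hy.frontier_add_closedBall hne hc hconv ht
  have hrange : range g = (fun θ => y θ + t • θ) '' (Metric.sphere 0 1 \ {e}) := by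
    rw [← h.range_stereo, ← range_comp]; rfl
  have hna : NullSingletonClass (μHE[finrank ℝ V] : Measure F) := by
    have : NullSingletonClass (Measure.hausdorffMeasure (finrank ℝ V : ℝ) : Measure F) :=
      Measure.nullSingletonClass_hausdorff F (by exact_mod_cast hV)
    rw [Measure.euclideanHausdorffMeasure_def]
    exact ⟨fun x => by simp [this.measure_singleton]⟩
  have hsd : frontier (K + Metric.closedBall 0 t) \ range g ⊆ {y e + t • e} := by
    rw [hfr, hrange]
    rintro _ ⟨⟨θ, hθ, rfl⟩, hn⟩
    by_cases hθe : θ = e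
    · rw [hθe]; rfl
    · exact absurd ⟨θ, ⟨hθ, hθe⟩, rfl⟩ hn
  have hss : range g ⊆ frontier (K + Metric.closedBall 0 t) := by
    rw [hfr, hrange]; exact image_mono sdiff_subset
  refine (ae_eq_set.2 ⟨?_, ?_⟩)
  · exact measure_mono_null hsd (measure_singleton _)
  · rw [sdiff_eq_empty.2 hss, measure_empty]

end SurfaceMeasure

/-! ### Polar coordinates -/

section Polar

open Filter Topology Module
open scoped RealInnerProductSpace NNReal ENNReal

lemma image_tan_half : (fun φ : ℝ => Real.tan (φ / 2)) '' Ioo 0 Real.pi = Ioi 0 := by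
  ext r
  constructor
  · rintro ⟨φ, ⟨h0, h1⟩, rfl⟩
    exact Real.tan_pos_of_pos_of_lt_pi_div_two (by linarith) (by linarith)
  · intro hr
    have hr : 0 < r := hr
    refine ⟨2 * Real.arctan r, ⟨?_, ?_⟩, ?_⟩
    · have := Real.arctan_pos.2 hr
      linarith
    · linarith [Real.arctan_lt_pi_div_two r]
    · simp only
      rw [mul_div_cancel_left₀ _ (two_ne_zero' ℝ), Real.tan_arctan]

/-- Substitution r = tan(φ/2), the relation between stereographic radius and the angle from −e. -/
lemma integral_Ioi_eq_integral_tan_half (g : ℝ → ℂ) :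
    ∫ r in Ioi (0 : ℝ), g r = ∫ φ in (0 : ℝ)..Real.pi,
      (((1 + Real.tan (φ / 2) ^ 2) / 2 : ℝ) : ℂ) * g (Real.tan (φ / 2)) := by
  have hcos : ∀ φ ∈ Ioo (0 : ℝ) Real.pi, 0 < Real.cos (φ / 2) := fun φ hφ =>
    Real.cos_pos_of_mem_Ioo ⟨by linarith [hφ.1, Real.pi_pos], by linarith [hφ.2]⟩
  rw [← image_tan_half, integral_image_eq_integral_abs_deriv_smul measurableSet_Ioo
    (f' := fun φ => (1 + Real.tan (φ / 2) ^ 2) / 2),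
    intervalIntegral.integral_of_le Real.pi_pos.le, integral_Ioc_eq_integral_Ioo]
  · refine setIntegral_congr_fun measurableSet_Ioo fun φ _ => ?_
    rw [abs_of_nonneg (by positivity), Complex.real_smul]
  · intro φ hφ
    have h1 := (Real.hasDerivAt_tan (hcos φ hφ).ne').comp φ ((hasDerivAt_id φ).div_const 2)
    refine (h1.congr_deriv ?_).hasDerivWithinAt
    have h2 := Real.one_add_tan_sq_mul_cos_sq_eq_one (hcos φ hφ).ne'
    have h3 : 1 / Real.cos (φ / 2) ^ 2 = 1 + Real.tan (φ / 2) ^ 2 := by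
      rw [div_eq_iff (pow_ne_zero 2 (hcos φ hφ).ne')]; exact h2.symm
    rw [h3]; ring
  · intro a ha b hb hab
    have := Real.injOn_tan (⟨by linarith [ha.1, Real.pi_pos], by linarith [ha.2]⟩ :
      a / 2 ∈ Ioo (-(Real.pi / 2)) (Real.pi / 2)) (⟨by linarith [hb.1, Real.pi_pos],
      by linarith [hb.2]⟩ : b / 2 ∈ Ioo (-(Real.pi / 2)) (Real.pi / 2)) hab
    linarith

variable {V F : Type*} [NormedAddCommGroup V] [InnerProductSpace ℝ V]
  [NormedAddCommGroup F] [InnerProductSpace ℝ F]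

/-- Rays from the origin correspond to meridians from −e (φ = 0) to e (φ = π), parametrized by arc
length. -/
lemma stereo_tan_half_smul {e : F} {U : V →ₗᵢ[ℝ] F} {η : V} (hη : ‖η‖ = 1) {φ : ℝ}
    (hφ : Real.cos (φ / 2) ≠ 0) :
    stereo e U (Real.tan (φ / 2) • η) = Real.sin φ • U η - Real.cos φ • e := by
  have h1 := Real.one_add_tan_sq_mul_cos_sq_eq_one hφ
  have hs : Real.sin φ = 2 * Real.sin (φ / 2) * Real.cos (φ / 2) := by
    rw [← Real.sin_two_mul]; congr 1; ring
  have hc : Real.cos φ = 2 * Real.cos (φ / 2) ^ 2 - 1 := by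
    rw [← Real.cos_two_mul]; congr 1; ring
  have ht : Real.tan (φ / 2) * Real.cos (φ / 2) = Real.sin (φ / 2) := Real.tan_mul_cos hφ
  have hn : ‖Real.tan (φ / 2) • η‖ ^ 2 = Real.tan (φ / 2) ^ 2 := by
    rw [norm_smul, hη, mul_one, Real.norm_eq_abs, sq_abs]
  have hinv : (1 + Real.tan (φ / 2) ^ 2)⁻¹ = Real.cos (φ / 2) ^ 2 :=
    inv_eq_of_mul_eq_one_right h1
  rw [stereo, hn, hinv, map_smul, smul_add, smul_smul, smul_smul, smul_smul,
    sub_eq_add_neg (Real.sin φ • U η), ← neg_smul]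
  congr 2
  · rw [hs, ← ht]; ring
  · rw [hc]; linarith

/-- Half-angle formulas: dr, the radial weight r^m and the conformal factor combine into the area
weight sin^m φ. -/
lemma stereoFactor_tan_half_smul {η : V} (hη : ‖η‖ = 1) {φ : ℝ}
    (hφ : Real.cos (φ / 2) ≠ 0) (m : ℕ) :
    (1 + Real.tan (φ / 2) ^ 2) / 2 * (Real.tan (φ / 2) ^ m *
      stereoFactor (Real.tan (φ / 2) • η) ^ (m + 1)) = Real.sin φ ^ m := by
  have h1 := Real.one_add_tan_sq_mul_cos_sq_eq_one hφ
  have hs : Real.sin φ = 2 * Real.sin (φ / 2) * Real.cos (φ / 2) := by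
    rw [← Real.sin_two_mul]; congr 1; ring
  have ht : Real.tan (φ / 2) * Real.cos (φ / 2) = Real.sin (φ / 2) := Real.tan_mul_cos hφ
  have hn : ‖Real.tan (φ / 2) • η‖ ^ 2 = Real.tan (φ / 2) ^ 2 := by
    rw [norm_smul, hη, mul_one, Real.norm_eq_abs, sq_abs]
  have hinv : (1 + Real.tan (φ / 2) ^ 2)⁻¹ = Real.cos (φ / 2) ^ 2 :=
    inv_eq_of_mul_eq_one_right h1
  rw [stereoFactor, hn, hinv, hs, ← ht, pow_succ (2 * Real.cos (φ / 2) ^ 2)]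
  have : (1 + Real.tan (φ / 2) ^ 2) / 2 * (Real.tan (φ / 2) ^ m *
      ((2 * Real.cos (φ / 2) ^ 2) ^ m * (2 * Real.cos (φ / 2) ^ 2)))
      = ((1 + Real.tan (φ / 2) ^ 2) * Real.cos (φ / 2) ^ 2) *
        (Real.tan (φ / 2) * (2 * Real.cos (φ / 2) ^ 2)) ^ m := by
    rw [mul_pow (Real.tan (φ / 2))]; ring
  rw [this, h1, one_mul]
  congr 1
  ring

variable [FiniteDimensional ℝ V] [MeasurableSpace V] [BorelSpace V]

/-- A bound for the radial integrals gives a bound for the integral. -/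
lemma norm_integral_le_of_norm_radial_integral_le [Nontrivial V] {G : V → ℂ} {B : ℝ} (hB : 0 ≤ B)
    (hG : ∀ η : V, ‖η‖ = 1 →
      ‖∫ r in Ioi (0 : ℝ), ((r ^ (finrank ℝ V - 1) : ℝ) : ℂ) * G (r • η)‖ ≤ B) :
    ‖∫ w, G w‖ ≤ (volume : Measure V).toSphere.real univ * B := by
  -- For a non-integrable G the integral is 0 by convention.
  by_cases hint : Integrable G
  swap
  · rw [integral_undef hint, norm_zero]
    positivity
  set μ : Measure V := volume
  have hmp := μ.measurePreserving_homeomorphUnitSphereProd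
  set H : Metric.sphere (0 : V) 1 × Ioi (0 : ℝ) → ℂ := fun z => G ((z.2 : ℝ) • (z.1 : V)) with hH
  have hHcomp : ∀ x : ({0}ᶜ : Set V), H (homeomorphUnitSphereProd V x) = G x := fun x => by
    have hx : ‖(x : V)‖ ≠ 0 := norm_ne_zero_iff.2 x.2
    simp [hH, smul_smul, hx]
  have h1 : ∫ w, G w = ∫ z, H z ∂(μ.toSphere.prod (.volumeIoiPow (finrank ℝ V - 1))) := by
    rw [← hmp.integral_comp (Homeomorph.measurableEmbedding _)]
    simp only [hHcomp]
    rw [integral_subtype_comap (measurableSet_singleton _).compl G, restrict_compl_singleton]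
  have h2 : Integrable H (μ.toSphere.prod (.volumeIoiPow (finrank ℝ V - 1))) := by
    rw [← hmp.integrable_comp_emb (Homeomorph.measurableEmbedding _)]
    have h3 : IntegrableOn G {0}ᶜ μ := hint.integrableOn
    rw [integrableOn_iff_comap_subtypeVal (measurableSet_singleton _).compl] at h3
    refine h3.congr (Eventually.of_forall fun x => ?_)
    exact (hHcomp x).symm
  rw [h1, integral_prod _ h2]
  have hinner : ∀ η : Metric.sphere (0 : V) 1,
      ‖∫ r, H (η, r) ∂(Measure.volumeIoiPow (finrank ℝ V - 1))‖ ≤ B := by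
    intro η
    have := hG η (by simp)
    convert! this using 2
    simp only [Measure.volumeIoiPow, ENNReal.ofReal]
    rw [integral_withDensity_eq_integral_smul, integral_subtype_comap measurableSet_Ioi
      fun a : ℝ => Real.toNNReal (a ^ (finrank ℝ V - 1)) • G (a • (η : V))]
    · refine setIntegral_congr_fun measurableSet_Ioi fun r hr => ?_
      rw [NNReal.smul_def, Real.coe_toNNReal _ (pow_nonneg (le_of_lt hr) _), Complex.real_smul]
    · exact (measurable_subtype_coe.pow_const _).real_toNNReal
  have := norm_integral_le_of_norm_le_const (μ := μ.toSphere) (Eventually.of_forall hinner)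
  rwa [mul_comm]

/-- Geodesic polar coordinates on the sphere about −e: a bound uniform over meridians is integrated
over their directions η. -/
theorem norm_integral_stereo_le (hV : 0 < finrank ℝ V) {e : F} {U : V →ₗᵢ[ℝ] F} {G : F → ℂ}
    {B : ℝ} (hB : 0 ≤ B)
    (hG : ∀ η : V, ‖η‖ = 1 → ‖∫ φ in (0 : ℝ)..Real.pi, (Real.sin φ : ℂ) ^ (finrank ℝ V - 1) *
      G (Real.sin φ • U η - Real.cos φ • e)‖ ≤ B) :
    ‖∫ w : V, ((stereoFactor w ^ finrank ℝ V : ℝ) : ℂ) * G (stereo e U w)‖ ≤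
      (volume : Measure V).toSphere.real univ * B := by
  have : Nontrivial V := nontrivial_of_finrank_pos hV
  refine norm_integral_le_of_norm_radial_integral_le hB fun η hη => ?_
  refine le_of_eq_of_le ?_ (hG η hη)
  rw [integral_Ioi_eq_integral_tan_half]
  congr 1
  rw [intervalIntegral.integral_of_le Real.pi_pos.le, intervalIntegral.integral_of_le
    Real.pi_pos.le, integral_Ioc_eq_integral_Ioo, integral_Ioc_eq_integral_Ioo]
  refine setIntegral_congr_fun measurableSet_Ioo fun φ hφ => ?_
  have hcos : Real.cos (φ / 2) ≠ 0 :=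
    (Real.cos_pos_of_mem_Ioo ⟨by linarith [hφ.1, Real.pi_pos], by linarith [hφ.2]⟩).ne'
  obtain ⟨m, hm⟩ : ∃ m, finrank ℝ V = m + 1 := ⟨finrank ℝ V - 1, by omega⟩
  simp only [hm, Nat.add_sub_cancel]
  rw [stereo_tan_half_smul hη hcos, ← mul_assoc, ← mul_assoc, ← Complex.ofReal_pow,
    ← stereoFactor_tan_half_smul hη hcos m]
  push_cast
  ring

end Polar

/-! ### Derivative bounds along great circles -/

section DerivativeBounds

open Filter Topology Module
open scoped RealInnerProductSpace

variable {W Y : Type*} [NormedAddCommGroup W] [NormedSpace ℝ W] [NormedAddCommGroup Y]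
  [NormedSpace ℝ Y]

lemma contDiff_trigCurve (a p q : W) :
    ContDiff ℝ ∞ (fun φ : ℝ => a + Real.sin φ • p + Real.cos φ • q) :=
  (contDiff_const.add (Real.contDiff_sin.smul contDiff_const)).add
    (Real.contDiff_cos.smul contDiff_const)

lemma norm_iteratedFDeriv_trigCurve_le (a : W) {p q : W} (hp : ‖p‖ ≤ 1) (hq : ‖q‖ ≤ 1) {i : ℕ}
    (hi : 1 ≤ i) (φ : ℝ) :
    ‖iteratedFDeriv ℝ i (fun φ : ℝ => a + Real.sin φ • p + Real.cos φ • q) φ‖ ≤ 2 := by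
  have h1 : ContDiff ℝ ∞ (fun φ : ℝ => Real.sin φ • p) := Real.contDiff_sin.smul contDiff_const
  have h2 : ContDiff ℝ ∞ (fun φ : ℝ => Real.cos φ • q) := Real.contDiff_cos.smul contDiff_const
  have hle : ((i : ℕ∞) : WithTop ℕ∞) ≤ ∞ := by exact_mod_cast le_top
  have e1 : ‖iteratedFDeriv ℝ i (fun φ : ℝ => Real.sin φ • p) φ‖ ≤ 1 := by
    have := ((1 : ℝ →L[ℝ] ℝ).smulRight p).norm_iteratedFDeriv_comp_left
      (f := Real.sin) (x := φ) Real.contDiff_sin.contDiffAt hle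
    refine this.trans ?_
    rw [ContinuousLinearMap.norm_smulRight_apply, norm_iteratedFDeriv_eq_norm_iteratedDeriv]
    have h3 := Real.abs_iteratedDeriv_sin_le_one i φ
    rw [← Real.norm_eq_abs] at h3
    have : ‖(1 : ℝ →L[ℝ] ℝ)‖ ≤ 1 := ContinuousLinearMap.norm_id_le
    have h4 : ‖(1 : ℝ →L[ℝ] ℝ)‖ * ‖p‖ ≤ 1 := mul_le_one₀ this (norm_nonneg _) hp
    exact mul_le_one₀ h4 (norm_nonneg _) h3
  have e2 : ‖iteratedFDeriv ℝ i (fun φ : ℝ => Real.cos φ • q) φ‖ ≤ 1 := by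
    have := ((1 : ℝ →L[ℝ] ℝ).smulRight q).norm_iteratedFDeriv_comp_left
      (f := Real.cos) (x := φ) Real.contDiff_cos.contDiffAt hle
    refine this.trans ?_
    rw [ContinuousLinearMap.norm_smulRight_apply, norm_iteratedFDeriv_eq_norm_iteratedDeriv]
    have h3 := Real.abs_iteratedDeriv_cos_le_one i φ
    rw [← Real.norm_eq_abs] at h3
    have : ‖(1 : ℝ →L[ℝ] ℝ)‖ ≤ 1 := ContinuousLinearMap.norm_id_le
    have h4 : ‖(1 : ℝ →L[ℝ] ℝ)‖ * ‖q‖ ≤ 1 := mul_le_one₀ this (norm_nonneg _) hq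
    exact mul_le_one₀ h4 (norm_nonneg _) h3
  have h3 : ContDiff ℝ ∞ (fun φ : ℝ => a + Real.sin φ • p) := contDiff_const.add h1
  have s1 := iteratedFDeriv_add_apply (x := φ) (i := i) (h3.of_le hle).contDiffAt
    (h2.of_le hle).contDiffAt
  have s2 := iteratedFDeriv_add_apply (x := φ) (i := i)
    ((contDiff_const (c := a) (n := ∞) (𝕜 := ℝ) (E := ℝ)).of_le hle).contDiffAt
    (h1.of_le hle).contDiffAt
  have s3 : iteratedFDeriv ℝ i (fun _ : ℝ => a) φ = 0 := by
    rw [iteratedFDeriv_const_of_ne (by omega)]; rfl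
  change ‖iteratedFDeriv ℝ i ((fun φ : ℝ => a + Real.sin φ • p) + fun φ => Real.cos φ • q) φ‖ ≤ 2
  rw [s1]
  change ‖iteratedFDeriv ℝ i ((fun _ : ℝ => a) + fun φ => Real.sin φ • p) φ + _‖ ≤ 2
  rw [s2, s3, zero_add]
  refine (norm_add_le _ _).trans ?_
  linarith

/-- Derivatives of a smooth function along bounded trigonometric curves are uniformly bounded. -/
lemma exists_norm_iteratedFDeriv_comp_trigCurve_le {g : W → Y} {s c : Set W} (hs : IsOpen s)
    (hg : ContDiffOn ℝ ∞ g s) (hc : IsCompact c) (hcs : c ⊆ s) (k : ℕ) :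
    ∃ C : ℝ, 0 ≤ C ∧ ∀ a p q : W, ‖p‖ ≤ 1 → ‖q‖ ≤ 1 →
      (∀ φ : ℝ, a + Real.sin φ • p + Real.cos φ • q ∈ c) →
      ContDiff ℝ ∞ (fun φ : ℝ => g (a + Real.sin φ • p + Real.cos φ • q)) ∧
      ∀ j ≤ k, ∀ φ : ℝ,
        ‖iteratedFDeriv ℝ j (fun φ : ℝ => g (a + Real.sin φ • p + Real.cos φ • q)) φ‖ ≤ C := by
  have hbd : ∀ i : ℕ, ∃ B, 0 ≤ B ∧ ∀ x ∈ c, ‖iteratedFDerivWithin ℝ i g s x‖ ≤ B := fun i => by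
    obtain ⟨B, hB⟩ := hc.exists_bound_of_continuousOn
      ((hg.continuousOn_iteratedFDerivWithin (m := i) (by exact_mod_cast le_top)
        hs.uniqueDiffOn).mono hcs)
    exact ⟨max B 0, le_max_right _ _, fun x hx => (hB x hx).trans (le_max_left _ _)⟩
  choose B hB0 hB using hbd
  set M := ∑ i ∈ Finset.range (k + 1), B i with hM
  have hM0 : 0 ≤ M := Finset.sum_nonneg fun i _ => hB0 i
  refine ⟨k.factorial * M * 2 ^ k, by positivity, fun a p q hp hq hmem => ⟨?_, fun j hj φ => ?_⟩⟩
  · exact hg.comp_contDiff (contDiff_trigCurve a p q) fun φ => hcs (hmem φ)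
  -- A quantitative Faà di Bruno bound; the derivatives of the curve of order i ≥ 1 are at most 2 ≤
  -- 2^i.
  · have := norm_iteratedFDeriv_comp_le' (n := j) (N := ∞)
      (f := fun φ : ℝ => a + Real.sin φ • p + Real.cos φ • q) (g := g) (t := s)
      (by rintro _ ⟨φ, rfl⟩; exact hcs (hmem φ)) hs.uniqueDiffOn hg (contDiff_trigCurve a p q)
      (by exact_mod_cast le_top) φ (C := M) (D := 2)
      (fun i hi => (hB i _ (hmem φ)).trans
        (Finset.single_le_sum (fun i _ => hB0 i) (Finset.mem_range.2 (by omega))))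
      (fun i hi _ => (norm_iteratedFDeriv_trigCurve_le a hp hq hi φ).trans
        (by simpa using pow_le_pow_right₀ (one_le_two (α := ℝ)) hi))
    refine this.trans ?_
    gcongr
    norm_num

lemma norm_iteratedFDeriv_cexp_mul_I (j : ℕ) (x : ℝ) :
    ‖iteratedFDeriv ℝ j (fun x : ℝ => Complex.exp ((x : ℂ) * Complex.I)) x‖ = 1 := by
  have h : ∀ j : ℕ, iteratedDeriv j (fun x : ℝ => Complex.exp ((x : ℂ) * Complex.I))
      = fun x : ℝ => Complex.I ^ j * Complex.exp ((x : ℂ) * Complex.I) := by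
    intro j
    induction j with
    | zero => simp
    | succ j ih =>
      rw [iteratedDeriv_succ, ih]
      ext x
      have h1 : HasDerivAt (fun x : ℝ => (x : ℂ) * Complex.I) Complex.I x := by
        simpa using (Complex.ofRealCLM.hasDerivAt (x := x)).mul_const Complex.I
      rw [(h1.cexp.const_mul (Complex.I ^ j)).deriv]
      ring
  rw [norm_iteratedFDeriv_eq_norm_iteratedDeriv, h]
  simp [Complex.norm_exp_ofReal_mul_I]

lemma contDiff_cexp_mul_I : ContDiff ℝ ∞ (fun x : ℝ => Complex.exp ((x : ℂ) * Complex.I)) :=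
  (Complex.ofRealCLM.contDiff.mul contDiff_const).cexp

/-- The outer function has derivatives of modulus 1; using 1 + A instead of A gives A ≤ (1 + A)^i
for all i ≥ 1. -/
lemma norm_iteratedFDeriv_cexp_comp_le {f : ℝ → ℝ} (hf : ContDiff ℝ ∞ f) {k : ℕ} {A : ℝ}
    (hA : 0 ≤ A) (hbd : ∀ j ≤ k, ∀ φ, ‖iteratedFDeriv ℝ j f φ‖ ≤ A) {j : ℕ} (hj : j ≤ k) (φ : ℝ) :
    ‖iteratedFDeriv ℝ j (fun φ => Complex.exp ((f φ : ℂ) * Complex.I)) φ‖ ≤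
      k.factorial * (1 + A) ^ k := by
  have := norm_iteratedFDeriv_comp_le (n := j) (N := ∞) contDiff_cexp_mul_I hf
    (by exact_mod_cast le_top) φ (C := 1) (D := 1 + A)
    (fun i _ => (norm_iteratedFDeriv_cexp_mul_I i _).le)
    (fun i hi hij => (hbd i (hij.trans hj) φ).trans (by
      have := pow_le_pow_right₀ (show (1 : ℝ) ≤ 1 + A by linarith) hi
      rw [pow_one] at this
      linarith))
  refine this.trans ?_
  rw [mul_one]
  gcongr
  linarith

variable {F : Type*} [NormedAddCommGroup F] [InnerProductSpace ℝ F]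

lemma norm_sin_smul_sub_cos_smul {p e : F} (hp : ‖p‖ = 1) (he : ‖e‖ = 1) (hpe : ⟪p, e⟫ = 0)
    (φ : ℝ) : ‖Real.sin φ • p + Real.cos φ • (-e)‖ = 1 := by
  have h : ‖Real.sin φ • p + Real.cos φ • (-e)‖ ^ 2 = 1 := by
    rw [norm_add_sq_real, norm_smul, norm_smul, norm_neg, hp, he, inner_smul_left, inner_smul_right,
      inner_neg_right, hpe]
    simp
  nlinarith [norm_nonneg (Real.sin φ • p + Real.cos φ • (-e))]

variable [FiniteDimensional ℝ F]

lemma contDiff_det : ContDiff ℝ ∞ (fun A : F →L[ℝ] F => LinearMap.det (A : F →ₗ[ℝ] F)) := by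
  set b := finBasis ℝ F
  have h : (fun A : F →L[ℝ] F => LinearMap.det (A : F →ₗ[ℝ] F)) = fun A : F →L[ℝ] F =>
      (LinearMap.toMatrix b b (A : F →ₗ[ℝ] F)).det := by
    ext A; rw [LinearMap.det_toMatrix]
  rw [h]
  simp only [Matrix.det_apply, LinearMap.toMatrix_apply]
  refine ContDiff.sum fun σ _ => ContDiff.const_smul _ (contDiff_prod fun i _ => ?_)
  have hcoord : (fun A : F →L[ℝ] F => b.repr ((A : F →ₗ[ℝ] F) (b i)) (σ i)) =
      fun A : F →L[ℝ] F => (LinearMap.toContinuousLinearMap (b.coord (σ i))) (A (b i)) := rfl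
  rw [hcoord]
  exact (ContinuousLinearMap.contDiff _).comp (contDiff_id.clm_apply contDiff_const)

variable {K : Set F} {y : F → F}

lemma IsSmoothSupportMap.contDiffOn_det (hy : IsSmoothSupportMap K y) :
    ContDiffOn ℝ ∞ (fun z : ℝ × F => LinearMap.det (1 + z.1 • (fderiv ℝ y z.2 : F →ₗ[ℝ] F)))
      (univ ×ˢ {0}ᶜ) := by
  have h1 : ContDiffOn ℝ ∞ (fun z : ℝ × F => ContinuousLinearMap.id ℝ F + z.1 • fderiv ℝ y z.2)
      (univ ×ˢ {0}ᶜ) := by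
    refine contDiffOn_const.add (contDiff_fst.contDiffOn.smul ?_)
    exact (hy.contDiffOn.fderiv_of_isOpen isOpen_compl_singleton (by simp)).comp
      contDiff_snd.contDiffOn fun z hz => hz.2
  exact contDiff_det.comp_contDiffOn h1

/-- The Jacobian of the normal chart is close to one far away from `K`. -/
lemma IsSmoothSupportMap.exists_half_le_det (hy : IsSmoothSupportMap K y) :
    ∃ t₀ : ℝ, 1 ≤ t₀ ∧ ∀ t, t₀ ≤ t → ∀ θ ∈ Metric.sphere (0 : F) 1,
      1 / 2 ≤ LinearMap.det (1 + t⁻¹ • (fderiv ℝ y θ : F →ₗ[ℝ] F)) := by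
  have hopen : IsOpen ((univ : Set ℝ) ×ˢ ({0}ᶜ : Set F)) := isOpen_univ.prod isOpen_compl_singleton
  have hev : ∀ᶠ s : ℝ in 𝓝 0, ∀ θ ∈ Metric.sphere (0 : F) 1,
      1 / 2 ≤ LinearMap.det (1 + s • (fderiv ℝ y θ : F →ₗ[ℝ] F)) := by
    -- At s = 0 the determinant is 1; compactness makes the neighbourhood of 0 uniform in θ.
    refine (isCompact_sphere (0 : F) 1).eventually_forall_of_forall_eventually fun θ hθ => ?_
    have hθ0 : θ ≠ 0 := fun h => by simp [h] at hθ
    have hc := hy.contDiffOn_det.continuousOn.continuousAt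
      (hopen.mem_nhds (mk_mem_prod (mem_univ (0 : ℝ)) hθ0))
    refine (hc.eventually (lt_mem_nhds (a := (1 / 2 : ℝ)) ?_)).mono fun z hz => hz.le
    norm_num
  have hinv := tendsto_inv_atTop_zero.eventually hev
  obtain ⟨t₀, ht₀⟩ := eventually_atTop.1 hinv
  exact ⟨max t₀ 1, le_max_right _ _, fun t ht => ht₀ t ((le_max_left _ _).trans ht)⟩

/-- The amplitude of the oscillatory integral over the unit sphere. -/
def sphereAmplitude (y : F → F) (s : ℝ) (ξ θ : F) : ℂ :=
  Complex.exp (((⟪ξ, y θ⟫ : ℝ) : ℂ) * Complex.I) *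
    ((LinearMap.det (1 + s • (fderiv ℝ y θ : F →ₗ[ℝ] F)) : ℝ) : ℂ)

/-- Each derivative of e^{i⟨ξ,y⟩} costs at most a factor 1 + |ξ| up to constants, and the
determinant is controlled on a compact set of (s, θ). With s = t⁻¹ in [0, 1], the bound is
independent of t ≥ 1. -/
theorem IsSmoothSupportMap.exists_norm_iteratedDeriv_sphereAmplitude_le
    (hy : IsSmoothSupportMap K y) (k : ℕ) :
    ∃ C : ℝ, 0 ≤ C ∧ ∀ (ξ : F) (s : ℝ) (p e : F), s ∈ Icc (0 : ℝ) 1 → ‖p‖ = 1 → ‖e‖ = 1 →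
      ⟪p, e⟫ = 0 →
      ContDiff ℝ ∞ (fun φ => sphereAmplitude y s ξ (Real.sin φ • p - Real.cos φ • e)) ∧
      ∀ j ≤ k, ∀ φ, ‖iteratedDeriv j
        (fun φ => sphereAmplitude y s ξ (Real.sin φ • p - Real.cos φ • e)) φ‖
          ≤ C * (1 + ‖ξ‖) ^ k := by
  have hsub : Metric.sphere (0 : F) 1 ⊆ {0}ᶜ := fun θ hθ h0 => by
    rw [mem_singleton_iff.1 h0] at hθ; simp at hθ
  obtain ⟨A, hA0, hA⟩ := exists_norm_iteratedFDeriv_comp_trigCurve_le isOpen_compl_singleton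
    hy.contDiffOn (isCompact_sphere (0 : F) 1) hsub k
  obtain ⟨D, hD0, hD⟩ := exists_norm_iteratedFDeriv_comp_trigCurve_le
    (isOpen_univ.prod isOpen_compl_singleton)
    (Complex.ofRealCLM.contDiff.comp_contDiffOn hy.contDiffOn_det)
    ((isCompact_Icc (a := (0 : ℝ)) (b := 1)).prod (isCompact_sphere (0 : F) 1))
    (prod_mono (subset_univ _) hsub) k
  refine ⟨2 ^ k * (k.factorial * (1 + A) ^ k) * D, by positivity,
    fun ξ s p e hs hp he hpe => ?_⟩
  have hmem : ∀ φ : ℝ, (0 : F) + Real.sin φ • p + Real.cos φ • (-e) ∈ Metric.sphere (0 : F) 1 :=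
    fun φ => by simpa using norm_sin_smul_sub_cos_smul hp he hpe φ
  obtain ⟨hA1, hA2⟩ := hA 0 p (-e) hp.le (by rw [norm_neg, he]) hmem
  -- A trigonometric curve in ℝ × F with its first coordinate frozen at s, which yields uniformity
  -- in s.
  obtain ⟨hD1, hD2⟩ := hD (s, 0) (0, p) (0, -e) (by simp [hp]) (by simp [he]) (fun φ => by
    simpa [hs.1, hs.2] using norm_sin_smul_sub_cos_smul hp he hpe φ)
  have hcurve : ∀ φ : ℝ, (0 : F) + Real.sin φ • p + Real.cos φ • (-e) =
      Real.sin φ • p - Real.cos φ • e := fun φ => by rw [zero_add, smul_neg, sub_eq_add_neg]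
  have hcurve' : ∀ φ : ℝ, ((s, 0) : ℝ × F) + Real.sin φ • (0, p) + Real.cos φ • (0, -e) =
      (s, Real.sin φ • p - Real.cos φ • e) := fun φ => by
    ext
    · simp
    · simp [sub_eq_add_neg]
  simp only [hcurve] at hA1 hA2
  simp only [hcurve', Function.comp_def, Complex.ofRealCLM_apply] at hD1 hD2
  set f : ℝ → ℝ := fun φ => ⟪ξ, y (Real.sin φ • p - Real.cos φ • e)⟫ with hf
  have hf1 : ContDiff ℝ ∞ f := (innerSL ℝ ξ).contDiff.comp hA1
  have hf2 : ∀ j ≤ k, ∀ φ, ‖iteratedFDeriv ℝ j f φ‖ ≤ ‖ξ‖ * A := fun j hj φ => by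
    refine ((innerSL ℝ ξ).norm_iteratedFDeriv_comp_left hA1.contDiffAt
      (by exact_mod_cast le_top)).trans ?_
    rw [innerSL_apply_norm]
    exact mul_le_mul_of_nonneg_left (hA2 j hj φ) (norm_nonneg _)
  have hexp : ContDiff ℝ ∞ (fun φ => Complex.exp ((f φ : ℂ) * Complex.I)) :=
    contDiff_cexp_mul_I.comp hf1
  refine ⟨hexp.mul hD1, fun j hj φ => ?_⟩
  refine (norm_iteratedDeriv_mul_le hexp hD1 hj (A := k.factorial * (1 + ‖ξ‖ * A) ^ k) (B := D)
    (fun i hi φ => ?_) (fun i hi φ => ?_) φ).trans ?_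
  · rw [← norm_iteratedFDeriv_eq_norm_iteratedDeriv]
    exact norm_iteratedFDeriv_cexp_comp_le hf1 (by positivity) hf2 hi φ
  · rw [← norm_iteratedFDeriv_eq_norm_iteratedDeriv]
    exact hD2 i hi φ
  · have h1 : 1 + ‖ξ‖ * A ≤ (1 + A) * (1 + ‖ξ‖) := by nlinarith [norm_nonneg ξ]
    calc 2 ^ k * (k.factorial * (1 + ‖ξ‖ * A) ^ k) * D
        ≤ 2 ^ k * (k.factorial * ((1 + A) * (1 + ‖ξ‖)) ^ k) * D := by gcongr
      _ = _ := by rw [mul_pow]; ring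

end DerivativeBounds

/-! ### Fourier transform and total mass of the surface measure -/

section SurfaceEstimates

open Filter Topology Module
open scoped RealInnerProductSpace

lemma exists_isPoleFrame {n : ℕ} {e : E (n + 1)} (he : ‖e‖ = 1) :
    ∃ U : E n →ₗᵢ[ℝ] E (n + 1), IsPoleFrame e U := by
  have : Fact (finrank ℝ (E (n + 1)) = n + 1) := ⟨finrank_euclideanSpace_fin⟩
  have he0 : e ≠ 0 := fun h => by rw [h, norm_zero] at he; exact zero_ne_one he
  set b := OrthonormalBasis.fromOrthogonalSpanSingleton (𝕜 := ℝ) n he0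
  refine ⟨(Submodule.subtypeₗᵢ _).comp b.repr.symm.toLinearIsometry, he, fun w => ?_,
    fun x hx => ?_⟩
  · exact Submodule.mem_orthogonal_singleton_iff_inner_left.1 (b.repr.symm w).2
  · have hx' := Submodule.mem_orthogonal_singleton_iff_inner_left.2 hx
    refine ⟨b.repr ⟨x, hx'⟩, ?_⟩
    simp

lemma integrable_stereoFactor_pow {n : ℕ} (hn : 0 < n) :
    Integrable (fun w : E n => stereoFactor w ^ n) := by
  have h := integrable_rpow_neg_one_add_norm_sq (E := E n) (μ := volume) (r := 2 * n)
    (by rw [finrank_euclideanSpace_fin]; have : (0 : ℝ) < n := by exact_mod_cast hn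
        linarith)
  refine (h.const_mul (2 ^ n)).congr (Eventually.of_forall fun w => ?_)
  have hp : (0 : ℝ) < 1 + ‖w‖ ^ 2 := by positivity
  simp only [stereoFactor]
  rw [mul_pow, show (-(2 * (n : ℝ)) / 2) = -(n : ℝ) by ring, Real.rpow_neg hp.le,
    Real.rpow_natCast, inv_pow]

lemma integral_stereoFactor_pow_pos {n : ℕ} (hn : 0 < n) :
    0 < ∫ w : E n, stereoFactor w ^ n := by
  rw [integral_pos_iff_support_of_nonneg (fun w => (pow_pos (stereoFactor_pos w) n).le)
    (integrable_stereoFactor_pow hn)]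
  have : Function.support (fun w : E n => stereoFactor w ^ n) = univ :=
    eq_univ_of_forall fun w => (pow_pos (stereoFactor_pos w) n).ne'
  rw [this]
  exact Measure.measure_univ_pos.2 (NeZero.ne _)

lemma parallelBody_eq {d : ℕ} (K : Set (E d)) {t : ℝ} (ht : 0 ≤ t) :
    parallelBody K t = K + Metric.closedBall 0 t := by
  rw [parallelBody, smul_unitClosedBall_of_nonneg ht]

variable {n : ℕ} {K : Set (E (n + 1))} {y : E (n + 1) → E (n + 1)}

lemma IsSmoothSupportMap.exists_det_le (hy : IsSmoothSupportMap K y) :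
    ∃ M : ℝ, 0 ≤ M ∧ ∀ s ∈ Icc (0 : ℝ) 1, ∀ θ ∈ Metric.sphere (0 : E (n + 1)) 1,
      |LinearMap.det (1 + s • (fderiv ℝ y θ : E (n + 1) →ₗ[ℝ] E (n + 1)))| ≤ M := by
  have hsub : Metric.sphere (0 : E (n + 1)) 1 ⊆ {0}ᶜ := fun θ hθ h0 => by
    rw [mem_singleton_iff.1 h0] at hθ; simp at hθ
  obtain ⟨M, hM⟩ := ((isCompact_Icc (a := (0 : ℝ)) (b := 1)).prod
    (isCompact_sphere (0 : E (n + 1)) 1)).exists_bound_of_continuousOn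
    (hy.contDiffOn_det.continuousOn.mono (prod_mono (subset_univ _) hsub))
  exact ⟨max M 0, le_max_right _ _, fun s hs θ hθ => (hM (s, θ) ⟨hs, hθ⟩).trans (le_max_left _ _)⟩

/-- The oscillatory integral of the surface measure in stereographic coordinates. -/
lemma IsSmoothSupportMap.norm_integral_parallelDensity_le (hn : 0 < n)
    (hy : IsSmoothSupportMap K y) : ∃ C : ℝ, 0 ≤ C ∧ ∀ (t : ℝ), 1 ≤ t →
      (∀ θ ∈ Metric.sphere (0 : E (n + 1)) 1,
        0 ≤ LinearMap.det (1 + t⁻¹ • (fderiv ℝ y θ : E (n + 1) →ₗ[ℝ] E (n + 1)))) →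
      ∀ (ξ e : E (n + 1)) (U : E n →ₗᵢ[ℝ] E (n + 1)), IsPoleFrame e U → ξ = ‖ξ‖ • e → 1 ≤ ‖ξ‖ →
        ‖∫ w, (parallelDensity y t e U w : ℂ) *
          Complex.exp (((⟪ξ, parallelChart y t e U w⟫ : ℝ) : ℂ) * Complex.I)‖ ≤
          C * (1 + ‖ξ‖) ^ n * (t ^ n * t ^ (-(n : ℝ) / 2)) := by
  obtain ⟨C₁, hC₁, h₁⟩ := exists_norm_integral_cosWave_sin_pow_le (n - 1)
  obtain ⟨C₂, hC₂, h₂⟩ := hy.exists_norm_iteratedDeriv_sphereAmplitude_le n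
  set σ := (volume : Measure (E n)).toSphere.real univ with hσ
  refine ⟨σ * C₁ * C₂, by positivity, fun t ht hdet ξ e U h hξ hξ1 => ?_⟩
  have ht0 : 0 < t := by linarith
  set l := t * ‖ξ‖ with hl
  have hl1 : t ≤ l := le_mul_of_one_le_right ht0.le hξ1
  -- Only t⟨ξ, θ⟩ = l⟨θ, e⟩ is treated as phase. The term ⟨ξ, y θ⟩ stays in the amplitude, where it
  -- costs powers of |ξ| but none of t.
  set G : E (n + 1) → ℂ := fun x => Complex.exp (((l * ⟪x, e⟫ : ℝ) : ℂ) * Complex.I) *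
    sphereAmplitude y t⁻¹ ξ x with hG
  have hfin : finrank ℝ (E n) = n := finrank_euclideanSpace_fin
  have heq : ∀ w : E n, (parallelDensity y t e U w : ℂ) *
      Complex.exp (((⟪ξ, parallelChart y t e U w⟫ : ℝ) : ℂ) * Complex.I) =
      ((t ^ n : ℝ) : ℂ) * (((stereoFactor w ^ n : ℝ) : ℂ) * G (stereo e U w)) := by
    intro w
    have hin : ⟪ξ, parallelChart y t e U w⟫ =
        l * ⟪stereo e U w, e⟫ + ⟪ξ, y (stereo e U w)⟫ := by
      have : ⟪ξ, stereo e U w⟫ = ‖ξ‖ * ⟪stereo e U w, e⟫ := by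
        conv_lhs => rw [hξ]
        rw [inner_smul_left, real_inner_comm]; simp
      rw [parallelChart, inner_add_right, inner_smul_right, this, hl]; ring
    simp only [hG, sphereAmplitude, parallelDensity, hin, hfin]
    rw [abs_of_nonneg (hdet _ (by simpa using h.norm_stereo w)), mul_pow, Complex.ofReal_add,
      add_mul, Complex.exp_add]
    push_cast
    ring
  simp only [heq]
  rw [integral_const_mul, norm_mul, Complex.norm_real, Real.norm_of_nonneg (by positivity)]
  have hmain := norm_integral_stereo_le (V := E n) (by rw [hfin]; exact hn) (e := e) (U := U)
    (G := G) (B := C₁ * (C₂ * (1 + ‖ξ‖) ^ n) * t ^ (-(n : ℝ) / 2)) (by positivity) (fun η hη => ?_)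
  · rw [hfin] at hmain
    calc t ^ n * _ ≤ t ^ n * (σ * (C₁ * (C₂ * (1 + ‖ξ‖) ^ n) * t ^ (-(n : ℝ) / 2))) := by gcongr
      _ = _ := by ring
  · obtain ⟨hs, hb⟩ := h₂ ξ t⁻¹ (U η) e ⟨by positivity, inv_le_one_of_one_le₀ ht⟩
      (by rw [U.norm_map, hη]) h.norm_pole (h.inner_pole η)
    have hb' := h₁ _ (C₂ * (1 + ‖ξ‖) ^ n) l hs (fun j hj => hb j (by omega)) (ht.trans hl1)
    have hexp : (((n - 1 : ℕ) : ℝ) + 1) = n := by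
      rw [Nat.cast_sub hn]; simp
    rw [hexp] at hb'
    -- The extra decay in |ξ| is discarded: only l ≥ t is kept.
    have hpow : l ^ (-(n : ℝ) / 2) ≤ t ^ (-(n : ℝ) / 2) :=
      Real.rpow_le_rpow_of_nonpos ht0 hl1 (by
        have : (0 : ℝ) ≤ n := Nat.cast_nonneg n
        linarith)
    refine le_trans (le_of_eq ?_) (hb'.trans (mul_le_mul_of_nonneg_left hpow (by positivity)))
    congr 2
    ext φ
    have hin : ⟪Real.sin φ • U η - Real.cos φ • e, e⟫ = -Real.cos φ := by
      rw [inner_sub_left, inner_smul_left, inner_smul_left, h.inner_pole, h.inner_self_pole]; simp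
    simp only [hG, hin, hfin, cosWave, mul_neg]
    ring

/-- The density lies between constant multiples of t^n times the round density, which gives the
volume bounds with any pole. For the Fourier integral the pole is chosen afresh for each ξ. -/
theorem IsStrictlyConvexSmooth.exists_surface_bounds (hn : 0 < n)
    (hK : IsStrictlyConvexSmooth K) :
    ∃ C c t₀ : ℝ, 0 ≤ C ∧ 0 < c ∧ 1 ≤ t₀ ∧ ∀ t, t₀ ≤ t →
      (μHE[n] : Measure (E (n + 1))) (frontier (parallelBody K t)) < ⊤ ∧
      c * t ^ n ≤ (μHE[n] : Measure (E (n + 1))).real (frontier (parallelBody K t)) ∧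
      ∀ ξ : E (n + 1), 1 ≤ ‖ξ‖ →
        ‖∫ x in frontier (parallelBody K t), Complex.exp (((⟪ξ, x⟫ : ℝ) : ℂ) * Complex.I)
            ∂(μHE[n] : Measure (E (n + 1)))‖ ≤
          C * (1 + ‖ξ‖) ^ n * (t ^ n * t ^ (-(n : ℝ) / 2)) := by
  obtain ⟨hne, hc, hconv, y, hy⟩ := hK.exists_isSmoothSupportMap
  obtain ⟨t₀, ht₀, hdet⟩ := hy.exists_half_le_det
  obtain ⟨C, hC, hosc⟩ := hy.norm_integral_parallelDensity_le hn
  obtain ⟨M, hM0, hM⟩ := hy.exists_det_le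
  have hI := integral_stereoFactor_pow_pos hn
  set I := ∫ w : E n, stereoFactor w ^ n with hIdef
  have hfin : finrank ℝ (E n) = n := finrank_euclideanSpace_fin
  have hfin' : finrank ℝ (E (n + 1)) = finrank ℝ (E n) + 1 := by
    rw [hfin]; exact finrank_euclideanSpace_fin
  -- The factor 1/2 is the lower bound for the determinant once t ≥ t₀.
  refine ⟨C, I / 2, t₀, hC, by positivity, ht₀, fun t ht => ?_⟩
  have ht1 : 1 ≤ t := ht₀.trans ht
  have ht0 : 0 < t := by linarith
  have hdett := hdet t ht
  have hmeas : ∀ (e : E (n + 1)) (U : E n →ₗᵢ[ℝ] E (n + 1)), IsPoleFrame e U → _ := fun e U h =>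
    hy.restrict_frontier_eq_map hfin' (by rw [hfin]; exact hn) hne hc hconv h ht0
      (fun θ hθ => by have := hdett θ hθ; linarith)
  rw [hfin] at hmeas
  rw [parallelBody_eq K ht0.le]
  have hdens : ∀ (e : E (n + 1)) (U : E n →ₗᵢ[ℝ] E (n + 1)), IsPoleFrame e U →
      Measurable (parallelDensity y t e U) ∧ ∀ w, 0 ≤ parallelDensity y t e U w ∧
        t ^ n / 2 * stereoFactor w ^ n ≤ parallelDensity y t e U w ∧
        parallelDensity y t e U w ≤ t ^ n * M * stereoFactor w ^ n := by
    intro e U h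
    have hsph : ∀ w, stereo e U w ∈ Metric.sphere (0 : E (n + 1)) 1 := fun w => by
      simpa using h.norm_stereo w
    refine ⟨Continuous.measurable ?_, fun w => ⟨?_, ?_, ?_⟩⟩
    · unfold parallelDensity
      refine Continuous.mul ((continuous_const.mul continuous_stereoFactor).pow _)
        (Continuous.abs ?_)
      have := hy.contDiffOn_det.continuousOn.comp_continuous
        (f := fun w : E n => (t⁻¹, stereo e U w))
        (continuous_const.prodMk (contDiff_stereo e U).continuous)
        fun w => ⟨mem_univ _, h.stereo_ne_zero w⟩
      exact this
    · unfold parallelDensity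
      exact mul_nonneg (pow_nonneg (mul_pos ht0 (stereoFactor_pos w)).le _) (abs_nonneg _)
    · unfold parallelDensity
      rw [hfin, mul_pow]
      have h1 := (hdett _ (hsph w)).trans (le_abs_self _)
      have h2 : 0 ≤ t ^ n * stereoFactor w ^ n :=
        mul_nonneg (pow_nonneg ht0.le _) (pow_nonneg (stereoFactor_pos w).le _)
      nlinarith
    · unfold parallelDensity
      rw [hfin, mul_pow]
      have h1 := hM t⁻¹ ⟨by positivity, inv_le_one_of_one_le₀ ht1⟩ _ (hsph w)
      have h2 : 0 ≤ t ^ n * stereoFactor w ^ n :=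
        mul_nonneg (pow_nonneg ht0.le _) (pow_nonneg (stereoFactor_pos w).le _)
      nlinarith
  have hint : ∀ (e : E (n + 1)) (U : E n →ₗᵢ[ℝ] E (n + 1)), IsPoleFrame e U →
      Integrable (parallelDensity y t e U) := fun e U h => by
    refine Integrable.mono' ((integrable_stereoFactor_pow hn).const_mul (t ^ n * M))
      (hdens e U h).1.aestronglyMeasurable (Eventually.of_forall fun w => ?_)
    rw [Real.norm_of_nonneg ((hdens e U h).2 w).1]
    exact ((hdens e U h).2 w).2.2
  have hmass : (μHE[n] : Measure (E (n + 1))) (frontier (K + Metric.closedBall 0 t)) < ⊤ ∧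
      I / 2 * t ^ n ≤
        (μHE[n] : Measure (E (n + 1))).real (frontier (K + Metric.closedBall 0 t)) := by
    set e : E (n + 1) := EuclideanSpace.single 0 1 with he
    obtain ⟨U, h⟩ := exists_isPoleFrame (n := n) (e := e) (by simp [he])
    obtain ⟨hemb, hmap⟩ := hmeas e U h
    have hval : (μHE[n] : Measure (E (n + 1))) (frontier (K + Metric.closedBall 0 t)) =
        ENNReal.ofReal (∫ w, parallelDensity y t e U w) := by
      rw [← Measure.restrict_apply_univ, hmap, hemb.map_apply, preimage_univ,
        withDensity_apply _ MeasurableSet.univ, Measure.restrict_univ,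
        ofReal_integral_eq_lintegral_ofReal (hint e U h)
          (Eventually.of_forall fun w => ((hdens e U h).2 w).1)]
    refine ⟨by rw [hval]; exact ENNReal.ofReal_lt_top, ?_⟩
    rw [measureReal_def, hval, ENNReal.toReal_ofReal
      (integral_nonneg fun w => ((hdens e U h).2 w).1)]
    calc I / 2 * t ^ n = ∫ w : E n, t ^ n / 2 * stereoFactor w ^ n := by
          rw [integral_const_mul]; ring
      _ ≤ _ := integral_mono ((integrable_stereoFactor_pow hn).const_mul _) (hint e U h)
          fun w => ((hdens e U h).2 w).2.1
  refine ⟨hmass.1, hmass.2, fun ξ hξ => ?_⟩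
  have hξ0 : ‖ξ‖ ≠ 0 := by linarith
  -- With this pole the phase depends on the polar angle alone.
  set e := ‖ξ‖⁻¹ • ξ with he
  have hξe : ξ = ‖ξ‖ • e := by rw [he, smul_smul, mul_inv_cancel₀ hξ0, one_smul]
  obtain ⟨U, h⟩ := exists_isPoleFrame (n := n) (e := e) (by
    rw [he, norm_smul, norm_inv, norm_norm, inv_mul_cancel₀ hξ0])
  obtain ⟨hemb, hmap⟩ := hmeas e U h
  have := hosc t ht1 (fun θ hθ => by have := hdett θ hθ; linarith) ξ e U h hξe hξ
  refine le_of_eq_of_le ?_ this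
  rw [hmap, hemb.integral_map, integral_withDensity_eq_integral_toReal_smul
    (hdens e U h).1.ennreal_ofReal (Eventually.of_forall fun _ => ENNReal.ofReal_lt_top)]
  congr 2
  ext w
  rw [ENNReal.toReal_ofReal ((hdens e U h).2 w).1, Complex.real_smul]

end SurfaceEstimates

/-! ### Fourier coefficients on the torus -/

section FourierCoefficients

open Filter Topology
open scoped RealInnerProductSpace

variable {d : ℕ}

/-- An integer frequency as a vector of `ℝ^d`. -/
def freqVec (ξ : Fin d → ℤ) : E d := WithLp.toLp 2 (fun i => (ξ i : ℝ))

theorem isOpenQuotientMap_proj (d : ℕ) : IsOpenQuotientMap (proj d) := by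
  have h : IsOpenQuotientMap (Pi.map fun (_ : Fin d) (x : ℝ) => (x : AddCircle (2 * Real.pi))) :=
    IsOpenQuotientMap.piMap fun _ => QuotientAddGroup.isOpenQuotientMap_mk
  exact h.comp (EuclideanSpace.equiv (Fin d) ℝ).toHomeomorph.isOpenQuotientMap

theorem continuous_proj (d : ℕ) : Continuous (proj d) := (isOpenQuotientMap_proj d).continuous

theorem proj_add (x y : E d) : proj d (x + y) = proj d x + proj d y := by
  ext i
  simp [proj]

theorem IsSmooth.continuous {f : Torus d → ℂ} (hf : IsSmooth f) : Continuous f :=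
  (isOpenQuotientMap_proj d).isQuotientMap.continuous_iff.2 (ContDiff.continuous hf)

theorem integrable_torus_of_continuous {f : Torus d → ℂ} (hf : Continuous f)
    (μ : Measure (Torus d)) [IsFiniteMeasure μ] : Integrable f μ :=
  hf.integrable_of_hasCompactSupport (HasCompactSupport.of_compactSpace f)

theorem continuous_fourierMode (ξ : Fin d → ℤ) : Continuous (fourierMode ξ) := by
  unfold fourierMode
  fun_prop

theorem prod_fourier_proj (ξ : Fin d → ℤ) (z : E d) :
    ∏ i, fourier (ξ i) (proj d z i) = Complex.exp (((⟪freqVec ξ, z⟫ : ℝ) : ℂ) * Complex.I) := by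
  have hpi : (Real.pi : ℂ) ≠ 0 := by exact_mod_cast Real.pi_ne_zero
  simp only [proj, fourier_coe_apply, ← Complex.exp_sum]
  congr 1
  simp only [freqVec, PiLp.inner_apply, RCLike.inner_apply, conj_trivial, Complex.ofReal_sum,
    Finset.sum_mul]
  refine Finset.sum_congr rfl fun i _ => ?_
  push_cast
  field_simp

theorem fourierMode_proj (ξ : Fin d → ℤ) (z : E d) :
    fourierMode ξ (proj d z) = (((2 * Real.pi) ^ (-(d : ℝ) / 2) : ℝ) : ℂ) *
      Complex.exp (((⟪freqVec ξ, z⟫ : ℝ) : ℂ) * Complex.I) := by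
  rw [fourierMode, prod_fourier_proj]

theorem norm_fourierMode (ξ : Fin d → ℤ) (x : Torus d) :
    ‖fourierMode ξ x‖ = (2 * Real.pi) ^ (-(d : ℝ) / 2) := by
  obtain ⟨z, rfl⟩ := (isOpenQuotientMap_proj d).surjective x
  rw [fourierMode_proj, norm_mul, Complex.norm_exp_ofReal_mul_I, mul_one, Complex.norm_real,
    Real.norm_of_nonneg (by positivity)]

theorem fourierMode_add_proj (ξ : Fin d → ℤ) (x : Torus d) (z : E d) :
    fourierMode ξ (x + proj d z) =
      fourierMode ξ x * Complex.exp (((⟪freqVec ξ, z⟫ : ℝ) : ℂ) * Complex.I) := by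
  obtain ⟨y, rfl⟩ := (isOpenQuotientMap_proj d).surjective x
  rw [← proj_add, fourierMode_proj, fourierMode_proj, inner_add_right, Complex.ofReal_add, add_mul,
    Complex.exp_add, mul_assoc]

theorem fourierCoeffTorus_translate (f : Torus d → ℂ) (ξ : Fin d → ℤ) (z : E d) :
    fourierCoeffTorus (fun x => f (x + proj d z)) ξ =
      Complex.exp (((⟪freqVec ξ, z⟫ : ℝ) : ℂ) * Complex.I) * fourierCoeffTorus f ξ := by
  unfold fourierCoeffTorus
  rw [← integral_add_right_eq_self (fun x => f x * conj (fourierMode ξ x)) (proj d z),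
    ← integral_const_mul]
  refine integral_congr_ae (ae_of_all _ fun x => ?_)
  simp only [fourierMode_add_proj, map_mul, ← Complex.exp_conj, Complex.conj_ofReal, Complex.conj_I]
  have h : Complex.exp (((⟪freqVec ξ, z⟫ : ℝ) : ℂ) * Complex.I) *
      Complex.exp (((⟪freqVec ξ, z⟫ : ℝ) : ℂ) * -Complex.I) = 1 := by
    rw [← Complex.exp_add]
    simp
  linear_combination (-(f (x + proj d z)) * conj (fourierMode ξ x)) * h

/-- The directional derivative of a function on the torus. -/
def torusDeriv (v : E d) (f : Torus d → ℂ) (x : Torus d) : ℂ :=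
  deriv (fun h : ℝ => f (x + proj d (h • v))) 0

theorem IsSmooth.hasDerivAt_translate {f : Torus d → ℂ} (hf : IsSmooth f) (v : E d) (x : Torus d)
    (h : ℝ) :
    HasDerivAt (fun h : ℝ => f (x + proj d (h • v))) (torusDeriv v f (x + proj d (h • v))) h := by
  obtain ⟨z, rfl⟩ := (isOpenQuotientMap_proj d).surjective x
  have key (y : E d) (s : ℝ) : HasDerivAt (fun h : ℝ => f (proj d y + proj d (h • v)))
      (fderiv ℝ (fun x : E d => f (proj d x)) (y + s • v) v) s := by
    have h1 : HasDerivAt (fun h : ℝ => y + h • v) v s := by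
      simpa using ((hasDerivAt_id s).smul_const v).const_add y
    have h2 : HasFDerivAt (fun x : E d => f (proj d x)) _ (y + s • v) :=
      ((ContDiff.differentiable hf (by simp)) (y + s • v)).hasFDerivAt
    simpa only [Function.comp_def, proj_add] using h2.comp_hasDerivAt s h1
  have e : torusDeriv v f (proj d z + proj d (h • v)) =
      fderiv ℝ (fun x : E d => f (proj d x)) (z + h • v) v := by
    rw [torusDeriv, ← proj_add, (key (z + h • v) 0).deriv, zero_smul, add_zero]
  rw [e]
  exact key z h

theorem IsSmooth.torusDeriv {f : Torus d → ℂ} (hf : IsSmooth f) (v : E d) :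
    IsSmooth (torusDeriv v f) := by
  have e : (fun x : E d => ConvexEquidistribution.torusDeriv v f (proj d x)) =
      fun x : E d => fderiv ℝ (fun x : E d => f (proj d x)) x v := by
    funext y
    have h1 : HasDerivAt (fun h : ℝ => y + h • v) v 0 := by
      simpa using ((hasDerivAt_id (0 : ℝ)).smul_const v).const_add y
    have h2 : HasFDerivAt (fun x : E d => f (proj d x))
        (fderiv ℝ (fun x : E d => f (proj d x)) y) (y + (0 : ℝ) • v) := by
      simpa using ((ContDiff.differentiable hf (by simp)) y).hasFDerivAt
    have h3 := h2.comp_hasDerivAt 0 h1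
    simp only [Function.comp_def, proj_add] at h3
    exact h3.deriv
  unfold IsSmooth
  rw [e]
  exact (ContDiff.fderiv_right hf (by simp)).clm_apply contDiff_const

/-- Differentiate at h = 0 the effect of translation by h v on the coefficient, once under the
integral and once on the explicit exponential. This replaces integration by parts on the torus. -/
theorem IsSmooth.fourierCoeffTorus_torusDeriv {f : Torus d → ℂ} (hf : IsSmooth f) (v : E d)
    (ξ : Fin d → ℤ) :
    fourierCoeffTorus (ConvexEquidistribution.torusDeriv v f) ξ =
      (((⟪freqVec ξ, v⟫ : ℝ) : ℂ) * Complex.I) * fourierCoeffTorus f ξ := by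
  have hg := (hf.torusDeriv v).continuous
  obtain ⟨M, hM⟩ := isCompact_univ.exists_bound_of_continuousOn hg.continuousOn
  have hm (h : ℝ) : Continuous fun x : Torus d =>
      f (x + proj d (h • v)) * conj (fourierMode ξ x) :=
    (hf.continuous.comp (continuous_id.add continuous_const)).mul
      (Complex.continuous_conj.comp (continuous_fourierMode ξ))
  have hm' : Continuous fun x : Torus d =>
      ConvexEquidistribution.torusDeriv v f (x + proj d ((0 : ℝ) • v)) *
        conj (fourierMode ξ x) :=
    (hg.comp (continuous_id.add continuous_const)).mul
      (Complex.continuous_conj.comp (continuous_fourierMode ξ))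
  have h1 := (hasDerivAt_integral_of_dominated_loc_of_deriv_le (μ := (volume : Measure (Torus d)))
    (F := fun (h : ℝ) (x : Torus d) => f (x + proj d (h • v)) * conj (fourierMode ξ x))
    (F' := fun (h : ℝ) (x : Torus d) =>
      ConvexEquidistribution.torusDeriv v f (x + proj d (h • v)) * conj (fourierMode ξ x))
    (x₀ := 0) (bound := fun _ => M * (2 * Real.pi) ^ (-(d : ℝ) / 2)) univ_mem
    (Eventually.of_forall fun h => (hm h).aestronglyMeasurable)
    (integrable_torus_of_continuous (hm 0) _) hm'.aestronglyMeasurable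
    (ae_of_all _ fun x h _ => by
      rw [norm_mul, RCLike.norm_conj, norm_fourierMode]
      gcongr
      exact hM _ (mem_univ _))
    (integrable_const _)
    (ae_of_all _ fun x h _ => (hf.hasDerivAt_translate v x h).mul_const _)).2
  have h2 : (fun h : ℝ => ∫ x : Torus d, f (x + proj d (h • v)) * conj (fourierMode ξ x)) =
      fun h : ℝ => Complex.exp ((h : ℂ) * (((⟪freqVec ξ, v⟫ : ℝ) : ℂ) * Complex.I)) *
        fourierCoeffTorus f ξ := by
    funext h
    have := fourierCoeffTorus_translate f ξ (h • v)
    rw [fourierCoeffTorus] at this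
    rw [this, inner_smul_right, Complex.ofReal_mul, mul_assoc]
  rw [h2] at h1
  have h3 : HasDerivAt (fun h : ℝ => Complex.exp ((h : ℂ) *
      (((⟪freqVec ξ, v⟫ : ℝ) : ℂ) * Complex.I)) * fourierCoeffTorus f ξ)
      ((((⟪freqVec ξ, v⟫ : ℝ) : ℂ) * Complex.I) * fourierCoeffTorus f ξ) 0 := by
    have := (((Complex.ofRealCLM.hasDerivAt (x := (0 : ℝ))).mul_const
      (((⟪freqVec ξ, v⟫ : ℝ) : ℂ) * Complex.I)).cexp).mul_const (fourierCoeffTorus f ξ)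
    simpa using this
  have h4 := h1.unique h3
  rw [← h4]
  unfold fourierCoeffTorus
  refine integral_congr_ae (ae_of_all _ fun x => ?_)
  have : proj d ((0 : ℝ) • v) = 0 := by
    ext i
    simp [proj]
  simp only [this, add_zero]

/-- The symbol `1 + |ξ|²`. -/
def symbol (ξ : Fin d → ℤ) : ℝ := 1 + ∑ i, (ξ i : ℝ) ^ 2

theorem one_le_symbol (ξ : Fin d → ℤ) : 1 ≤ symbol ξ :=
  le_add_of_nonneg_right (Finset.sum_nonneg fun _ _ => sq_nonneg _)

theorem symbol_eq (ξ : Fin d → ℤ) : symbol ξ = 1 + ‖freqVec ξ‖ ^ 2 := by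
  rw [symbol, EuclideanSpace.norm_sq_eq]
  simp [freqVec]

/-- Take g = (1 − Δ) f. -/
theorem IsSmooth.exists_fourierCoeffTorus_eq_symbol_mul {f : Torus d → ℂ} (hf : IsSmooth f) :
    ∃ g : Torus d → ℂ, IsSmooth g ∧
      ∀ ξ, fourierCoeffTorus g ξ = (symbol ξ : ℂ) * fourierCoeffTorus f ξ := by
  let b (i : Fin d) : E d := EuclideanSpace.single i 1
  let D (i : Fin d) : Torus d → ℂ :=
    ConvexEquidistribution.torusDeriv (b i) (ConvexEquidistribution.torusDeriv (b i) f)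
  have hD (i : Fin d) : IsSmooth (D i) := (hf.torusDeriv _).torusDeriv _
  refine ⟨fun x => f x - ∑ i, D i x,
    ContDiff.sub hf (ContDiff.sum fun i _ => hD i), fun ξ => ?_⟩
  have hint {g : Torus d → ℂ} (hg : IsSmooth g) :
      Integrable (fun x => g x * conj (fourierMode ξ x)) (volume : Measure (Torus d)) :=
    integrable_torus_of_continuous
      (hg.continuous.mul (Complex.continuous_conj.comp (continuous_fourierMode ξ))) _
  have hc (i : Fin d) : fourierCoeffTorus (D i) ξ = -((ξ i : ℂ) ^ 2) * fourierCoeffTorus f ξ := by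
    have hb : ⟪freqVec ξ, b i⟫ = (ξ i : ℝ) := by
      simp [b, freqVec, EuclideanSpace.inner_single_right]
    rw [(hf.torusDeriv (b i)).fourierCoeffTorus_torusDeriv, hf.fourierCoeffTorus_torusDeriv, hb]
    push_cast
    linear_combination ((ξ i : ℂ) ^ 2 * fourierCoeffTorus f ξ) * Complex.I_mul_I
  have hsum : fourierCoeffTorus (fun x => f x - ∑ i, D i x) ξ =
      fourierCoeffTorus f ξ - ∑ i, fourierCoeffTorus (D i) ξ := by
    unfold fourierCoeffTorus
    simp only [sub_mul, Finset.sum_mul]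
    rw [integral_sub (hint hf) (integrable_finsetSum _ fun i _ => hint (hD i)),
      integral_finsetSum _ fun i _ => hint (hD i)]
  rw [hsum, Finset.sum_congr rfl fun i _ => hc i, ← Finset.sum_mul, symbol]
  push_cast
  rw [Finset.sum_neg_distrib]
  ring

/-- Coefficients of a bounded function are bounded; apply this to (1 − Δ)^N f. -/
theorem IsSmooth.exists_symbol_pow_mul_le {f : Torus d → ℂ} (hf : IsSmooth f) (N : ℕ) :
    ∃ C : ℝ, ∀ ξ, symbol ξ ^ N * ‖fourierCoeffTorus f ξ‖ ≤ C := by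
  induction N generalizing f with
  | zero =>
    obtain ⟨M, hM⟩ := isCompact_univ.exists_bound_of_continuousOn hf.continuous.continuousOn
    refine ⟨M * (2 * Real.pi) ^ (-(d : ℝ) / 2) * (volume : Measure (Torus d)).real univ,
      fun ξ => ?_⟩
    rw [pow_zero, one_mul]
    refine norm_integral_le_of_norm_le_const (ae_of_all _ fun x => ?_)
    rw [norm_mul, RCLike.norm_conj, norm_fourierMode]
    gcongr
    exact hM _ (mem_univ _)
  | succ N ih =>
    obtain ⟨g, hg, hgf⟩ := hf.exists_fourierCoeffTorus_eq_symbol_mul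
    obtain ⟨C, hC⟩ := ih hg
    refine ⟨C, fun ξ => ?_⟩
    have h := hC ξ
    rw [hgf, norm_mul, Complex.norm_real,
      Real.norm_of_nonneg (zero_le_one.trans (one_le_symbol ξ))] at h
    rwa [pow_succ, mul_assoc]

theorem summable_inv_one_add_int_sq : Summable fun k : ℤ => (1 + (k : ℝ) ^ 2)⁻¹ := by
  have h1 : Summable fun k : ℤ => 2 * ((1 : ℝ) / (k : ℝ) ^ 2) :=
    ((Real.summable_one_div_int_pow (p := 2)).2 one_lt_two).mul_left 2
  refine Summable.of_norm_bounded_eventually h1 ?_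
  filter_upwards [Filter.eventually_cofinite_ne (0 : ℤ)] with k hk
  have hk' : (0 : ℝ) < (k : ℝ) ^ 2 := by positivity
  rw [Real.norm_of_nonneg (by positivity), inv_eq_one_div, ← mul_div_assoc, mul_one,
    div_le_div_iff₀ (by positivity) hk']
  nlinarith

theorem summable_prod_inv_one_add_int_sq (d : ℕ) :
    Summable fun ξ : Fin d → ℤ => ∏ i, (1 + (ξ i : ℝ) ^ 2)⁻¹ := by
  induction d with
  | zero => exact (hasSum_fintype _).summable
  | succ d ih =>
    rw [← (Fin.consEquiv fun _ : Fin (d + 1) => ℤ).summable_iff]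
    have := summable_inv_one_add_int_sq.mul_of_nonneg ih (fun k => by positivity)
      (fun ξ => Finset.prod_nonneg fun i _ => by positivity)
    refine this.congr fun p => ?_
    simp [Fin.prod_univ_succ, Fin.consEquiv, mul_comm]

/-- Each factor 1 + ξ_i² is at most the symbol, so a product of one-dimensional summable families
dominates. -/
theorem summable_inv_symbol_pow (d : ℕ) :
    Summable fun ξ : Fin d → ℤ => (symbol ξ ^ d)⁻¹ := by
  refine (summable_prod_inv_one_add_int_sq d).of_nonneg_of_le
    (fun ξ => inv_nonneg.2 (pow_nonneg (zero_le_one.trans (one_le_symbol ξ)) _)) fun ξ => ?_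
  rw [Finset.prod_inv_distrib]
  refine inv_anti₀ (Finset.prod_pos fun i _ => by positivity) ?_
  calc ∏ i, (1 + (ξ i : ℝ) ^ 2) ≤ ∏ _i : Fin d, symbol ξ := by
        refine Finset.prod_le_prod (fun i _ => by positivity) fun i hi => ?_
        rw [symbol]
        gcongr
        exact Finset.single_le_sum (f := fun j => (ξ j : ℝ) ^ 2) (fun j _ => sq_nonneg _) hi
    _ = symbol ξ ^ d := by simp

theorem IsSmooth.summable_symbol_pow_mul_sq {f : Torus d → ℂ} (hf : IsSmooth f) (N : ℕ) :
    Summable fun ξ => symbol ξ ^ N * ‖fourierCoeffTorus f ξ‖ ^ 2 := by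
  -- The d additional powers provide the summable majorant C² · symbol^(−d).
  obtain ⟨C, hC⟩ := hf.exists_symbol_pow_mul_le (N + d)
  refine ((summable_inv_symbol_pow d).mul_left (C ^ 2)).of_nonneg_of_le
    (fun ξ => mul_nonneg (pow_nonneg (zero_le_one.trans (one_le_symbol ξ)) _) (sq_nonneg _))
    fun ξ => ?_
  have hq := one_le_symbol ξ
  have hq0 : 0 < symbol ξ := zero_lt_one.trans_le hq
  have h1 := hC ξ
  rw [← div_eq_mul_inv, le_div_iff₀ (by positivity)]
  calc symbol ξ ^ N * ‖fourierCoeffTorus f ξ‖ ^ 2 * symbol ξ ^ d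
      = symbol ξ ^ (N + d) * ‖fourierCoeffTorus f ξ‖ ^ 2 := by ring
    _ ≤ symbol ξ ^ (2 * (N + d)) * ‖fourierCoeffTorus f ξ‖ ^ 2 := by
        gcongr ?_ * _
        exact pow_le_pow_right₀ hq (by omega)
    _ = (symbol ξ ^ (N + d) * ‖fourierCoeffTorus f ξ‖) ^ 2 := by ring
    _ ≤ C ^ 2 := by gcongr

/-- Weighted Cauchy–Schwarz for the Fourier coefficients of a smooth function. -/
theorem exists_tsum_fourierCoeffTorus_mul_le (n : ℕ) (hn : n ≤ d) :
    ∃ A : ℝ, 0 ≤ A ∧ ∀ f : Torus d → ℂ, IsSmooth f →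
      (Summable fun ξ => ‖fourierCoeffTorus f ξ‖ * (1 + ‖freqVec ξ‖) ^ n) ∧
      ∑' ξ, ‖fourierCoeffTorus f ξ‖ * (1 + ‖freqVec ξ‖) ^ n ≤
        A * sobolevNorm (2 * d + 1) f := by
  -- The dual weight for Cauchy–Schwarz. Its square is at most 2^n · symbol^(n − 2d − 1), dominated
  -- by 2^n · symbol^(−d) because n ≤ d.
  let b (ξ : Fin d → ℤ) : ℝ := (1 + ‖freqVec ξ‖) ^ n * (√(symbol ξ ^ (2 * d + 1)))⁻¹
  have hb0 (ξ) : 0 ≤ b ξ := by positivity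
  have hbs : Summable fun ξ => b ξ ^ (2 : ℝ) := by
    refine ((summable_inv_symbol_pow d).mul_left (2 ^ n)).of_nonneg_of_le
      (fun ξ => by have := hb0 ξ; positivity) fun ξ => ?_
    have hq := one_le_symbol ξ
    have hq0 : 0 < symbol ξ := zero_lt_one.trans_le hq
    have h1 : (1 + ‖freqVec ξ‖) ^ 2 ≤ 2 * symbol ξ := by
      rw [symbol_eq]
      nlinarith [sq_nonneg (1 - ‖freqVec ξ‖)]
    rw [Real.rpow_two, mul_pow, inv_pow, Real.sq_sqrt (by positivity), ← pow_mul, mul_comm n 2,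
      pow_mul, ← div_eq_mul_inv, ← div_eq_mul_inv, div_le_div_iff₀ (by positivity) (by positivity)]
    calc ((1 + ‖freqVec ξ‖) ^ 2) ^ n * symbol ξ ^ d
        ≤ (2 * symbol ξ) ^ n * symbol ξ ^ d := by gcongr
      _ = 2 ^ n * symbol ξ ^ (n + d) := by ring
      _ ≤ 2 ^ n * symbol ξ ^ (2 * d + 1) := by
        gcongr ?_ * ?_
        exact pow_le_pow_right₀ hq (by omega)
  refine ⟨√(∑' ξ, b ξ ^ (2 : ℝ)), Real.sqrt_nonneg _, fun f hf => ?_⟩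
  let a (ξ : Fin d → ℤ) : ℝ := √(symbol ξ ^ (2 * d + 1)) * ‖fourierCoeffTorus f ξ‖
  have ha0 (ξ) : 0 ≤ a ξ := by positivity
  have ha2 (ξ) : a ξ ^ (2 : ℝ) = symbol ξ ^ (2 * d + 1) * ‖fourierCoeffTorus f ξ‖ ^ 2 := by
    have hq := one_le_symbol ξ
    have hq0 : 0 < symbol ξ := zero_lt_one.trans_le hq
    rw [Real.rpow_two, mul_pow, Real.sq_sqrt (by positivity)]
  have has : Summable fun ξ => a ξ ^ (2 : ℝ) :=
    (hf.summable_symbol_pow_mul_sq (2 * d + 1)).congr fun ξ => (ha2 ξ).symm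
  have hab (ξ) : a ξ * b ξ = ‖fourierCoeffTorus f ξ‖ * (1 + ‖freqVec ξ‖) ^ n := by
    have hq := one_le_symbol ξ
    have hq0 : 0 < √(symbol ξ ^ (2 * d + 1)) :=
      Real.sqrt_pos.2 (pow_pos (zero_lt_one.trans_le hq) _)
    simp only [a, b]
    field_simp
  have key := Real.summable_and_inner_le_Lp_mul_Lq_tsum_of_nonneg
    Real.HolderConjugate.two_two ha0 hb0 has hbs
  simp only [hab] at key
  refine ⟨key.1, key.2.trans_eq ?_⟩
  rw [← Real.sqrt_eq_rpow, ← Real.sqrt_eq_rpow, mul_comm, sobolevNorm]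
  congr 3
  funext ξ
  rw [ha2, ← Real.rpow_natCast]
  push_cast
  rfl

end FourierCoefficients

/-! ### Fourier series on the torus -/

section FourierSeries

open Filter Topology
open scoped RealInnerProductSpace

variable {d : ℕ}

/-- The rescaling of the torus `ℝ^d / ℤ^d` to `ℝ^d / 2πℤ^d`. -/
def torusScale (d : ℕ) : UnitAddTorus (Fin d) ≃+ Torus d :=
  AddEquiv.piCongrRight fun _ =>
    AddCircle.equivAddCircle 1 (2 * Real.pi) one_ne_zero Real.two_pi_pos.ne'

theorem continuous_torusScale (d : ℕ) : Continuous (torusScale d) :=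
  continuous_pi fun i =>
    (AddCircle.homeomorphAddCircle 1 (2 * Real.pi) one_ne_zero
      Real.two_pi_pos.ne').continuous.comp (continuous_apply i)

theorem prod_fourier_torusScale (ξ : Fin d → ℤ) (x : UnitAddTorus (Fin d)) :
    ∏ i, fourier (ξ i) (torusScale d x i) = UnitAddTorus.mFourier ξ x := by
  refine Finset.prod_congr rfl fun i _ => ?_
  have hpi : (Real.pi : ℂ) ≠ 0 := by exact_mod_cast Real.pi_ne_zero
  obtain ⟨z, hz⟩ := QuotientAddGroup.mk_surjective (x i)
  have e : torusScale d x i =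
      ((z * ((1 : ℝ)⁻¹ * (2 * Real.pi)) : ℝ) : AddCircle (2 * Real.pi)) := by
    rw [← AddCircle.equivAddCircle_apply_mk 1 (2 * Real.pi) one_ne_zero Real.two_pi_pos.ne' z]
    exact congrArg _ hz.symm
  rw [e, ← hz]
  refine fourier_coe_apply.trans (Eq.trans ?_ fourier_coe_apply.symm)
  congr 1
  push_cast
  field_simp

/-- Both measures are Haar probability measures, and a continuous surjective homomorphism carries
one to the other. -/
theorem measurePreserving_torusScale (d : ℕ) :
    MeasurePreserving (torusScale d)
      (Measure.pi fun _ => (AddCircle.haarAddCircle : Measure UnitAddCircle))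
      ((ENNReal.ofReal ((2 * Real.pi) ^ d))⁻¹ • (volume : Measure (Torus d))) := by
  have hpos : 0 < (2 * Real.pi) ^ d := pow_pos Real.two_pi_pos d
  have : Measure.IsAddHaarMeasure
      ((ENNReal.ofReal ((2 * Real.pi) ^ d))⁻¹ • (volume : Measure (Torus d))) :=
    Measure.IsAddHaarMeasure.smul _ (ENNReal.inv_ne_zero.2 ENNReal.ofReal_ne_top)
      (ENNReal.inv_ne_top.2 (ENNReal.ofReal_pos.2 hpos).ne')
  refine AddMonoidHom.measurePreserving (f := (torusScale d).toAddMonoidHom)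
    (continuous_torusScale d) (torusScale d).surjective ?_
  have hv : (volume : Measure (Torus d)) univ = ENNReal.ofReal ((2 * Real.pi) ^ d) := by
    rw [volume_pi, Measure.pi_univ]
    simp [ENNReal.ofReal_pow Real.two_pi_pos.le]
  rw [Measure.smul_apply, hv, smul_eq_mul,
    ENNReal.inv_mul_cancel (ENNReal.ofReal_pos.2 hpos).ne' ENNReal.ofReal_ne_top, measure_univ]

theorem mFourierCoeff_comp_torusScale {f : Torus d → ℂ} (hf : Continuous f) (ξ : Fin d → ℤ) :
    UnitAddTorus.mFourierCoeff (fun x => f (torusScale d x)) ξ =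
      (((2 * Real.pi) ^ (-(d : ℝ) / 2) : ℝ) : ℂ) * fourierCoeffTorus f ξ := by
  have hpos : 0 < (2 * Real.pi) ^ d := pow_pos Real.two_pi_pos d
  let F (x : Torus d) : ℂ := f x * conj (∏ i, fourier (ξ i) (x i))
  have hF : Continuous F := by
    refine hf.mul (Complex.continuous_conj.comp ?_)
    fun_prop
  have h1 : UnitAddTorus.mFourierCoeff (fun x => f (torusScale d x)) ξ =
      ∫ x, F (torusScale d x)
        ∂(Measure.pi fun _ => (AddCircle.haarAddCircle : Measure UnitAddCircle)) := by
    refine integral_congr_ae (ae_of_all _ fun x => ?_)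
    simp only [F, UnitAddTorus.mFourier_neg, prod_fourier_torusScale, smul_eq_mul, mul_comm]
  have h2 := (measurePreserving_torusScale d).map_eq
  have h3 : ∫ x, F x ∂((ENNReal.ofReal ((2 * Real.pi) ^ d))⁻¹ • (volume : Measure (Torus d))) =
      ∫ x, F (torusScale d x)
        ∂(Measure.pi fun _ => (AddCircle.haarAddCircle : Measure UnitAddCircle)) := by
    rw [← h2]
    exact integral_map (continuous_torusScale d).aemeasurable hF.aestronglyMeasurable
  have h4 : fourierCoeffTorus f ξ =
      (((2 * Real.pi) ^ (-(d : ℝ) / 2) : ℝ) : ℂ) * ∫ x, F x := by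
    rw [fourierCoeffTorus, ← integral_const_mul]
    refine integral_congr_ae (ae_of_all _ fun x => ?_)
    simp only [F, fourierMode, map_mul, Complex.conj_ofReal]
    ring
  have h5 : (2 * Real.pi) ^ (-(d : ℝ) / 2) * (2 * Real.pi) ^ (-(d : ℝ) / 2) =
      ((2 * Real.pi) ^ d)⁻¹ := by
    rw [← Real.rpow_add Real.two_pi_pos, ← Real.rpow_natCast, ← Real.rpow_neg Real.two_pi_pos.le]
    congr 1
    ring
  rw [h1, ← h3, integral_smul_measure, h4, ← mul_assoc, ← Complex.ofReal_mul, h5,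
    ENNReal.toReal_inv, ENNReal.toReal_ofReal hpos.le, Complex.real_smul]

/-- The Fourier series of a continuous function with summable coefficients. -/
theorem hasSum_fourierCoeffTorus_mul {f : Torus d → ℂ} (hf : Continuous f)
    (hs : Summable (fourierCoeffTorus f)) (x : Torus d) :
    HasSum (fun ξ => fourierCoeffTorus f ξ * fourierMode ξ x) (f x) := by
  obtain ⟨z, rfl⟩ := (torusScale d).surjective x
  have hc (ξ) := mFourierCoeff_comp_torusScale hf ξ
  have h := UnitAddTorus.hasSum_mFourier_series_apply_of_summable
    (f := ⟨fun x => f (torusScale d x), hf.comp (continuous_torusScale d)⟩)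
    ((hs.mul_left _).congr fun ξ => (hc ξ).symm) z
  refine h.congr_fun fun ξ => ?_
  rw [smul_eq_mul, ← prod_fourier_torusScale]
  refine Eq.trans ?_ (congrArg (· * _) (hc ξ).symm)
  simp only [fourierMode]
  ring

end FourierSeries

/-! ### Equidistribution from decay of exponential sums -/

section Equidistribution

open Filter Topology
open scoped RealInnerProductSpace

variable {d : ℕ}

theorem one_le_norm_freqVec {ξ : Fin d → ℤ} (hξ : ξ ≠ 0) : 1 ≤ ‖freqVec ξ‖ := by
  obtain ⟨i, hi⟩ := Function.ne_iff.1 hξ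
  have h1 : (1 : ℝ) ≤ |(ξ i : ℝ)| := by exact_mod_cast Int.one_le_abs hi
  exact h1.trans (PiLp.norm_apply_le (freqVec ξ) i)

/-- Decay of the exponential sums of a measure on the torus gives equidistribution of the measure
against smooth functions. -/
theorem exists_norm_average_sub_le (n : ℕ) (hn : n ≤ d) :
    ∃ A : ℝ, 0 ≤ A ∧ ∀ (μ : Measure (Torus d)) [IsFiniteMeasure μ] (B : ℝ), 0 ≤ B →
      0 < μ.real univ →
      (∀ ξ : Fin d → ℤ, ξ ≠ 0 →
        ‖∫ x, fourierMode ξ x ∂μ‖ ≤ B * (1 + ‖freqVec ξ‖) ^ n * μ.real univ) →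
      ∀ f : Torus d → ℂ, IsSmooth f →
        ‖(((μ.real univ)⁻¹ : ℝ) : ℂ) * (∫ x, f x ∂μ)
            - ((((2 * Real.pi) ^ d)⁻¹ : ℝ) : ℂ) * ∫ x, f x‖
          ≤ B * (A * sobolevNorm (2 * d + 1) f) := by
  obtain ⟨A, hA, H⟩ := exists_tsum_fourierCoeffTorus_mul_le (d := d) n hn
  refine ⟨A, hA, fun μ _ B hB0 hμ hB f hf => ?_⟩
  obtain ⟨hs, hle⟩ := H f hf
  have hfs : Summable fun ξ => ‖fourierCoeffTorus f ξ‖ := by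
    refine hs.of_nonneg_of_le (fun _ => norm_nonneg _) fun ξ => ?_
    exact le_mul_of_one_le_right (norm_nonneg _)
      (one_le_pow₀ (le_add_of_nonneg_right (norm_nonneg _)))
  have hsum : HasSum (fun ξ => fourierCoeffTorus f ξ * ∫ x, fourierMode ξ x ∂μ)
      (∫ x, f x ∂μ) := by
    have h1 := hasSum_integral_of_summable_integral_norm (μ := μ)
      (F := fun ξ x => fourierCoeffTorus f ξ * fourierMode ξ x)
      (fun ξ => integrable_torus_of_continuous
        (continuous_const.mul (continuous_fourierMode ξ)) _)
      (by
        simp only [norm_mul, norm_fourierMode, integral_const, smul_eq_mul]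
        exact (hfs.mul_right _).mul_left _)
    have h2 (x : Torus d) : ∑' ξ, fourierCoeffTorus f ξ * fourierMode ξ x = f x :=
      (hasSum_fourierCoeffTorus_mul hf.continuous hfs.of_norm x).tsum_eq
    simpa only [h2, integral_const_mul] using h1
  -- The mean of f is written as a series supported at frequency 0, where it cancels the
  -- corresponding term of the first series exactly.
  have hsum' := (hsum.mul_left (((μ.real univ)⁻¹ : ℝ) : ℂ)).sub
    (hasSum_ite_eq (0 : Fin d → ℤ) (((((2 * Real.pi) ^ d)⁻¹ : ℝ) : ℂ) * ∫ x, f x))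
  rw [← hsum'.tsum_eq]
  refine (tsum_of_norm_bounded ((hs.hasSum).mul_left B) fun ξ => ?_).trans ?_
  · have hpos : (0 : ℝ) < 2 * Real.pi := Real.two_pi_pos
    by_cases hξ : ξ = 0
    · subst hξ
      have e (x : Torus d) :
          fourierMode (0 : Fin d → ℤ) x = (((2 * Real.pi) ^ (-(d : ℝ) / 2) : ℝ) : ℂ) := by
        simp [fourierMode]
      have h5 : (2 * Real.pi) ^ (-(d : ℝ) / 2) * (2 * Real.pi) ^ (-(d : ℝ) / 2) =
          ((2 * Real.pi) ^ d)⁻¹ := by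
        rw [← Real.rpow_add hpos, ← Real.rpow_natCast, ← Real.rpow_neg hpos.le]
        congr 1
        ring
      have hm : (μ.real univ : ℂ) ≠ 0 := by exact_mod_cast hμ.ne'
      have h0 : (((μ.real univ)⁻¹ : ℝ) : ℂ) *
          (fourierCoeffTorus f 0 * ∫ x, fourierMode (0 : Fin d → ℤ) x ∂μ) =
          ((((2 * Real.pi) ^ d)⁻¹ : ℝ) : ℂ) * ∫ x, f x := by
        simp only [fourierCoeffTorus, e, Complex.conj_ofReal, integral_mul_const, integral_const,
          Complex.real_smul]
        rw [← h5, Complex.ofReal_mul, Complex.ofReal_inv]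
        field_simp
      rw [if_pos rfl, h0, sub_self, norm_zero]
      positivity
    · rw [if_neg hξ, sub_zero, norm_mul, norm_mul, Complex.norm_real,
        Real.norm_of_nonneg (inv_nonneg.2 hμ.le)]
      calc (μ.real univ)⁻¹ * (‖fourierCoeffTorus f ξ‖ * ‖∫ x, fourierMode ξ x ∂μ‖)
          ≤ (μ.real univ)⁻¹ * (‖fourierCoeffTorus f ξ‖ *
            (B * (1 + ‖freqVec ξ‖) ^ n * μ.real univ)) := by
            gcongr
            exact hB ξ hξ
        _ = B * (‖fourierCoeffTorus f ξ‖ * (1 + ‖freqVec ξ‖) ^ n) := by field_simp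
  · gcongr

/-- The exponential sums of the surface measure are Fourier integrals over the parallel surface. -/
theorem integral_fourierMode_surfaceMeasure (K : Set (E d)) (t : ℝ) (ξ : Fin d → ℤ) :
    ∫ x, fourierMode ξ x ∂(surfaceMeasure K t) = (((2 * Real.pi) ^ (-(d : ℝ) / 2) : ℝ) : ℂ) *
      ∫ x in frontier (parallelBody K t), Complex.exp (((⟪freqVec ξ, x⟫ : ℝ) : ℂ) * Complex.I)
        ∂(μHE[d - 1] : Measure (E d)) := by
  rw [surfaceMeasure, integral_map (continuous_proj d).aemeasurable
    (continuous_fourierMode ξ).aestronglyMeasurable, ← integral_const_mul]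
  simp only [fourierMode_proj]

theorem surfaceMeasure_univ (K : Set (E d)) (t : ℝ) :
    surfaceMeasure K t univ =
      (μHE[d - 1] : Measure (E d)) (frontier (parallelBody K t)) := by
  rw [surfaceMeasure, Measure.map_apply (continuous_proj d).measurable MeasurableSet.univ,
    preimage_univ, Measure.restrict_apply_univ]

end Equidistribution

end ConvexEquidistribution

end

theorem theorem10p1 (d : ℕ) (hd : 2 ≤ d) (K : Set (ConvexEquidistribution.E d))
    (hK : ConvexEquidistribution.IsStrictlyConvexSmooth K) :
    ∃ C t₀ : ℝ, 0 < C ∧ 0 < t₀ ∧ ∀ t : ℝ, t₀ ≤ t →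
      0 < (ConvexEquidistribution.surfaceMeasure K t) univ ∧
      (ConvexEquidistribution.surfaceMeasure K t) univ < ⊤ ∧
      ∀ f : ConvexEquidistribution.Torus d → ℂ, ConvexEquidistribution.IsSmooth f →
        Integrable f (ConvexEquidistribution.surfaceMeasure K t) ∧
        ‖((((ConvexEquidistribution.surfaceMeasure K t).real univ)⁻¹ : ℝ) : ℂ) *
              (∫ x, f x ∂(ConvexEquidistribution.surfaceMeasure K t))
            - ((((2 * Real.pi) ^ d)⁻¹ : ℝ) : ℂ) * ∫ x, f x‖
          ≤ C * ConvexEquidistribution.sobolevNorm (2 * d + 1) f * t ^ (-((d : ℝ) - 1) / 2) := by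
  obtain ⟨n, rfl⟩ : ∃ n, d = n + 1 := ⟨d - 1, by omega⟩
  obtain ⟨C, c, t₀, hC, hc, ht₀, H⟩ := hK.exists_surface_bounds (by omega : 0 < n)
  obtain ⟨A, hA, hav⟩ :=
    ConvexEquidistribution.exists_norm_average_sub_le (d := n + 1) n (Nat.le_succ n)
  let w : ℝ := (2 * Real.pi) ^ (-((n + 1 : ℕ) : ℝ) / 2)
  have hw : 0 ≤ w := by positivity
  -- The summand 1 only ensures a positive constant, since C or A may vanish.
  refine ⟨w * (C / c) * A + 1, t₀, by positivity, by linarith, fun t ht => ?_⟩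
  obtain ⟨hfin, hlow, hosc⟩ := H t ht
  have ht0 : 0 < t := by linarith
  have hreal : (ConvexEquidistribution.surfaceMeasure K t).real univ =
      (μHE[n] : Measure (ConvexEquidistribution.E (n + 1))).real
        (frontier (ConvexEquidistribution.parallelBody K t)) := by
    rw [Measure.real, ConvexEquidistribution.surfaceMeasure_univ, Nat.add_sub_cancel]
    rfl
  have hlt : ConvexEquidistribution.surfaceMeasure K t univ < ⊤ := by
    rw [ConvexEquidistribution.surfaceMeasure_univ]
    exact hfin
  have hpos : 0 < (ConvexEquidistribution.surfaceMeasure K t).real univ := by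
    rw [hreal]
    exact (by positivity : 0 < c * t ^ n).trans_le hlow
  have : IsFiniteMeasure (ConvexEquidistribution.surfaceMeasure K t) := ⟨hlt⟩
  refine ⟨(ENNReal.toReal_pos_iff.1 hpos).1, hlt, fun f hf =>
    ⟨ConvexEquidistribution.integrable_torus_of_continuous hf.continuous _, ?_⟩⟩
  have hS : 0 ≤ ConvexEquidistribution.sobolevNorm (2 * ((n + 1 : ℕ) : ℝ) + 1) f :=
    Real.sqrt_nonneg _
  have hexp : -(((n + 1 : ℕ) : ℝ) - 1) / 2 = -(n : ℝ) / 2 := by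
    push_cast
    ring
  rw [hexp]
  -- Dividing by the volume, at least c t^n, turns the bound on the Fourier integral into decay
  -- t^(−n/2) of averages; w is the normalization of the Fourier modes.
  refine (hav (ConvexEquidistribution.surfaceMeasure K t) (w * (C / c) * t ^ (-(n : ℝ) / 2))
    (by positivity) hpos (fun ξ hξ => ?_) f hf).trans ?_
  · rw [ConvexEquidistribution.integral_fourierMode_surfaceMeasure, norm_mul, Complex.norm_real,
      Real.norm_of_nonneg hw, hreal]
    calc w * _ ≤ w * (C * (1 + ‖ConvexEquidistribution.freqVec ξ‖) ^ n *
            (t ^ n * t ^ (-(n : ℝ) / 2))) := by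
          gcongr
          exact hosc _ (ConvexEquidistribution.one_le_norm_freqVec hξ)
      _ = w * (C / c) * t ^ (-(n : ℝ) / 2) *
            (1 + ‖ConvexEquidistribution.freqVec ξ‖) ^ n * (c * t ^ n) := by
          field_simp
      _ ≤ _ := by gcongr
  · have : 0 ≤ ConvexEquidistribution.sobolevNorm (2 * ((n + 1 : ℕ) : ℝ) + 1) f *
        t ^ (-(n : ℝ) / 2) := by positivity
    linarith
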